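/- Let $d_1,d_2,D\ge 1$. A gauge function is a strictly increasing continuous function $q:[0,r)\to\mathbb{R}_+$ ($0<r\le\infty$) with $q(0)=0$. Call a gauge function $q$ regular in dimension $d$ if it is differentiable on $(0,r)$ and there are Borel functions $\varphi,\psi$ and constants $c_0,c>0$ such that $$q(s\tau)\le\varphi(\tau)\,q(s),\qquad \dot q(s\tau)\le\tfrac1s\,\psi(\tau)\,q(s\tau)\qquad\text{for all } s,\tau\in(0,c_0],$$ and $\int_0^1\log^p\!\big(1+\tfrac{c}{\tau^{2d}}\big)\varphi(\tau)\psi(\tau)\,d\tau$ converges absolutely for all $p\ge1$. Let $I\subset\mathbb{R}^{d_1}$ and $J\subset\mathbb{R}^{d_2}$ be compact sets of positive Lebesgue measure, and for $\eta>0$ let $I^{(\eta)}$, $J^{(\eta)}$ denote their open $\eta$-neighbourhoods. Let $q_1$ and $q_2$ be gauge functions that are regular in dimension $d_1$ and $d_2$, respectively, such that $$\bar g_q(\tau)=\frac{\tau^D}{\big(q_1^{-1}(\tau)\big)^{d_1}\big(q_2^{-1}(\tau)\big)^{d_2}},\qquad \bar g_q(0)=0,$$ is strictly increasing on some interval $(0,\rho_0)$.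 Let $\sigma>0$ and $K\in\mathbb{R}$. Then there is a constant $C>0$, depending only on $I,J,\sigma,d_1,d_2,D,q_1,q_2$ and $K$, such that the following holds. Let $U=\{U(t,x)=(U_1(t,x),\dots,U_D(t,x)):(t,x)\in\mathbb{R}^{d_1}\times\mathbb{R}^{d_2}\}$ be a (not necessarily centred) Gaussian random field on a probability space, with almost surely continuous sample paths and with independent and identically distributed component processes $U_1,\dots,U_D$. Suppose that for some $\eta>0$ (i) $\operatorname{Var}U_i(t,x)\ge\sigma^2$ for all $i$ and all $(t,x)\in I^{(\eta)}\times J^{(\eta)}$; (ii) for all sufficiently small $\varepsilon>0$, uniformly in $t\in I^{(\eta)}$ and $x\in J^{(\eta)}$, $$E\Big(\sup_{y\in J^{(\eta)}}\int_{B_\varepsilon(t)}ds\int_{B_\varepsilon(t)}d\bar s\ \exp\Big(\frac{|U(s,y)-U(\bar s,y)|}{q_1(|s-\bar s|)}\Big)\Big)\le K\varepsilon^{2d_1},$$ $$E\Big(\sup_{s\in I^{(\eta)}}\int_{B_\varepsilon(x)}dy\int_{B_\varepsilon(x)}d\bar y\ \exp\Big(\frac{|U(s,y)-U(s,\bar y)|}{q_2(|y-\bar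 y|)}\Big)\Big)\le K\varepsilon^{2d_2}.$$ Then for every Borel set $A\subset\mathbb{R}^D$, $$P\big(U(I\times J)\cap A\neq\emptyset\big)\le C\,\mathcal{H}_{\bar g_q}(A),$$ where $$\mathcal{H}_g(A)=\lim_{\varepsilon\downarrow0}\inf\Big\{\sum_{i=1}^\infty g(2r_i):\ A\subset\bigcup_{i=1}^\infty B_{r_i}(x_i),\ 0\le r_i\le\varepsilon\Big\}$$ and $B_r(x)$ is the open Euclidean ball (empty if $r=0$). -/

import Mathlib

open MeasureTheory ProbabilityTheory
open scoped ENNReal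

/-- The half-open interval `[0, r)` of real numbers, where `0 < r ≤ ∞`. -/
def gaugeDomain (r : ℝ≥0∞) : Set ℝ :=
  {s : ℝ | 0 ≤ s ∧ ENNReal.ofReal s < r}

/-- `q` is a gauge function on `[0, r)`: strictly increasing, continuous and `q 0 = 0`.
The values of `q` outside `[0, r)` play no role. -/
structure IsGauge (r : ℝ≥0∞) (q : ℝ → ℝ) : Prop where
  pos : 0 < r
  zero : q 0 = 0
  strictMonoOn : StrictMonoOn q (gaugeDomain r)
  continuousOn : ContinuousOn q (gaugeDomain r)

/-- The regularity required of a gauge function that controls oscillations over balls of `ℝ^d`: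
`q` is differentiable on `(0, r)` and, for all small `s, τ > 0`,
`q (s τ) ≤ φ τ * q s` and `q' (s τ) ≤ (1 / s) * ψ τ * q (s τ)`, where `φ` and `ψ` are Borel and
`∫₀¹ log (1 + c / τ ^ (2 d)) ^ p * φ τ * ψ τ dτ` converges absolutely for every `p ≥ 1`. -/
structure IsRegularGauge (d : ℕ) (r : ℝ≥0∞) (q : ℝ → ℝ) : Prop extends IsGauge r q where
  differentiableAt : ∀ s ∈ gaugeDomain r, 0 < s → DifferentiableAt ℝ q s
  growth : ∃ φ ψ : ℝ → ℝ, Measurable φ ∧ Measurable ψ ∧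
    (∃ c₀ : ℝ, 0 < c₀ ∧ ∀ s ∈ Set.Ioc 0 c₀, ∀ τ ∈ Set.Ioc 0 c₀,
      q (s * τ) ≤ φ τ * q s ∧ deriv q (s * τ) ≤ 1 / s * ψ τ * q (s * τ)) ∧
    ∃ c : ℝ, 0 < c ∧ ∀ p : ℝ, 1 ≤ p →
      IntegrableOn (fun τ : ℝ => Real.log (1 + c / τ ^ (2 * d)) ^ p * (φ τ * ψ τ))
        (Set.Ioo 0 1) volume

/-- The inverse of `q : [0, r) → q([0, r))`; only its values on the range of `q`, which contains
a neighbourhood of `0` in `[0, ∞)`, are meaningful. -/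
noncomputable def gaugeInv (r : ℝ≥0∞) (q : ℝ → ℝ) : ℝ → ℝ :=
  Function.invFunOn q (gaugeDomain r)

/-- `τ ^ D / (q₁⁻¹(τ) ^ d₁ * q₂⁻¹(τ) ^ d₂)`. For `D ≥ 1` the value at `τ = 0` is `0`. -/
noncomputable def gBar (d₁ d₂ D : ℕ) (r₁ r₂ : ℝ≥0∞) (q₁ q₂ : ℝ → ℝ) (τ : ℝ) : ℝ :=
  τ ^ D / (gaugeInv r₁ q₁ τ ^ d₁ * gaugeInv r₂ q₂ τ ^ d₂)

/-- The `g`-Hausdorff measure of `A`: the limit as `ε ↓ 0` (a supremum, by monotonicity) of the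
infimum of `∑ g (2 rᵢ)` over the countable coverings of `A` by open balls of radii `rᵢ ≤ ε`.
A ball of radius `0` is empty, so finite coverings are included. -/
noncomputable def gHausdorff {D : ℕ} (g : ℝ → ℝ) (A : Set (EuclideanSpace ℝ (Fin D))) : ℝ≥0∞ :=
  ⨆ (ε : ℝ) (_ : 0 < ε),
    ⨅ (x : ℕ → EuclideanSpace ℝ (Fin D)) (ρ : ℕ → ℝ)
      (_ : (∀ i, 0 ≤ ρ i ∧ ρ i ≤ ε) ∧ A ⊆ ⋃ i, Metric.ball (x i) (ρ i)),
      ∑' i, ENNReal.ofReal (g (2 * ρ i))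

/-- `U` is a Gaussian random field indexed by `ℝ^d₁ × ℝ^d₂`, with values in `ℝ^D`, with almost
surely continuous sample paths, whose `D` coordinate processes are independent and have the same
law. -/
structure IsContinuousGaussianIIDField {d₁ d₂ D : ℕ} {Ω : Type*} [MeasurableSpace Ω]
    (P : Measure Ω)
    (U : EuclideanSpace ℝ (Fin d₁) → EuclideanSpace ℝ (Fin d₂) → Ω →
      EuclideanSpace ℝ (Fin D)) : Prop where
  measurable : ∀ t x, Measurable (U t x)
  gaussian : IsGaussianProcess
    (fun (z : EuclideanSpace ℝ (Fin d₁) × EuclideanSpace ℝ (Fin d₂)) ω => U z.1 z.2 ω) P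
  continuous : ∀ᵐ ω ∂P, Continuous
    (fun z : EuclideanSpace ℝ (Fin d₁) × EuclideanSpace ℝ (Fin d₂) => U z.1 z.2 ω)
  indep : iIndepFun
    (fun (i : Fin D) (ω : Ω)
      (z : EuclideanSpace ℝ (Fin d₁) × EuclideanSpace ℝ (Fin d₂)) => U z.1 z.2 ω i) P
  identDistrib : ∀ i j : Fin D, IdentDistrib
    (fun (ω : Ω) (z : EuclideanSpace ℝ (Fin d₁) × EuclideanSpace ℝ (Fin d₂)) => U z.1 z.2 ω i)
    (fun (ω : Ω) (z : EuclideanSpace ℝ (Fin d₁) × EuclideanSpace ℝ (Fin d₂)) => U z.1 z.2 ω j)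
    P P

/-- The oscillation control with constant `K` on `S ⊆ ℝ^d₁` and `T ⊆ ℝ^d₂`: for all small `ε > 0`,
uniformly in `t ∈ S` and `x ∈ T`, the expectation of the supremum over `y ∈ T` of
`∫∫ exp (|U(s,y) - U(s',y)| / q₁ |s - s'|)` over `B_ε(t) × B_ε(t)` is at most `K ε^(2 d₁)`, and
symmetrically in the second variable with `q₂` and `K ε^(2 d₂)`. -/
def OscillationControl {d₁ d₂ D : ℕ} {Ω : Type*} [MeasurableSpace Ω] (P : Measure Ω)
    (U : EuclideanSpace ℝ (Fin d₁) → EuclideanSpace ℝ (Fin d₂) → Ω →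
      EuclideanSpace ℝ (Fin D))
    (q₁ q₂ : ℝ → ℝ) (K : ℝ)
    (S : Set (EuclideanSpace ℝ (Fin d₁))) (T : Set (EuclideanSpace ℝ (Fin d₂))) : Prop :=
  ∃ ε₀ : ℝ, 0 < ε₀ ∧ ∀ ε : ℝ, 0 < ε → ε < ε₀ →
    (∀ t ∈ S,
      ∫⁻ ω, ⨆ y ∈ T, (∫⁻ s in Metric.ball t ε, ∫⁻ s' in Metric.ball t ε,
        ENNReal.ofReal (Real.exp (‖U s y ω - U s' y ω‖ / q₁ ‖s - s'‖))) ∂P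
        ≤ ENNReal.ofReal (K * ε ^ (2 * d₁))) ∧
    (∀ x ∈ T,
      ∫⁻ ω, ⨆ s ∈ S, (∫⁻ y in Metric.ball x ε, ∫⁻ y' in Metric.ball x ε,
        ENNReal.ofReal (Real.exp (‖U s y ω - U s y' ω‖ / q₂ ‖y - y'‖))) ∂P
        ≤ ENNReal.ofReal (K * ε ^ (2 * d₂)))

/-! By countable subadditivity over coverings of `A`, it suffices that the field hits a single ball
of small radius `ε` from `I × J` with probability at most `C ḡ(ε)`
(`exists_measure_hit_ball_le_gBar`). Put `sᵢ = qᵢ⁻¹(ε)`. About `s₁^(-d₁) s₂^(-d₂)` products of balls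
of radii comparable to `s₁` and `s₂` cover `I × J`, so each block may contribute `O(ε ^ D)`.

On such a block the field oscillates by `O(ε)` in mean square. This is a Garsia–Rodemich–Rumsey
argument (`norm_sub_le_of_exp_energy`): averages over shrinking balls are chained. At level `n` the
energy bound loses a factor exponential in `n`, hence only a factor `n + 1` after taking logarithms,
while regularity makes the gauge decay like `(n + 1)⁻³` (`IsRegularGauge.exists_dyadic_decay`), so
the increments are summable.

For one coordinate `V` and the block centre `t₀`, regress on `X = V t₀`: `V t = X + β t * X + Y t`
with `Y` independent of `X`. The oscillation bound makes `β` of order `ε` and, up to the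
deterministic shift `β t * E X`, makes `Y` of order `ε`. As `X` has variance at least `σ²`, `V`
comes within `ε` of a given point with probability `O(ε)`
(`IsGaussianProcess.measure_exists_abs_sub_lt_le`). No bound on the mean of `X` is available, so the
part `β t * (X - E X)` is absorbed multiplicatively. Independence of the coordinates then gives `O(ε
^ D)`. -/

/-! ### Decay of regular gauges along dyadic scales. -/

theorem one_add_pow_le_one_add_mul_two_pow {c : ℝ} (hc : 0 ≤ c) (hc1 : c ≤ 1) (m : ℕ) :
    (1 + c) ^ m ≤ 1 + c * (2 ^ m - 1) := by
  induction m with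
  | zero => simp
  | succ k ih =>
    have h2 : (1 : ℝ) ≤ 2 ^ k := one_le_pow₀ (by norm_num)
    have hc2 : c * c ≤ c := by nlinarith
    calc (1 + c) ^ (k + 1) = (1 + c) ^ k * (1 + c) := pow_succ _ _
      _ ≤ (1 + c * (2 ^ k - 1)) * (1 + c) := by gcongr
      _ = 1 + c * 2 ^ k + (c * c) * (2 ^ k - 1) := by ring
      _ ≤ 1 + c * 2 ^ k + c * (2 ^ k - 1) := by
        have := mul_le_mul_of_nonneg_right hc2 (sub_nonneg.2 h2)
        linarith
      _ = 1 + c * (2 ^ (k + 1) - 1) := by ring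

/-- The logarithmic weight in the regularity integral grows linearly in the number of dyadic scales.
The power `(1 + c) ^ m` lies below its chord on `[0, 1]`, and `min c 1` brings `c` into that range.
-/
theorem mul_log_one_add_min_le {c x : ℝ} (hc : 0 < c) (m : ℕ) (hx : (2 : ℝ) ^ m ≤ x) :
    m * Real.log (1 + min c 1) ≤ Real.log (1 + c * x) := by
  have h1 : 0 < min c 1 := lt_min hc one_pos
  rw [← Real.log_pow]
  apply Real.log_le_log (by positivity)
  calc (1 + min c 1) ^ m ≤ 1 + min c 1 * (2 ^ m - 1) :=
        one_add_pow_le_one_add_mul_two_pow h1.le (min_le_right _ _) m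
    _ ≤ 1 + c * x := by
        have h2 : (1 : ℝ) ≤ 2 ^ m := one_le_pow₀ (by norm_num)
        have := mul_le_mul (min_le_left c 1) (by linarith : (2 : ℝ) ^ m - 1 ≤ x)
          (by linarith) hc.le
        linarith

theorem exists_Icc_subset_gaugeDomain {r : ℝ≥0∞} (hr : 0 < r) :
    ∃ s : ℝ, 0 < s ∧ Set.Icc 0 s ⊆ gaugeDomain r := by
  obtain ⟨s, hs0, hsr⟩ := ENNReal.lt_iff_exists_nnreal_btwn.1 hr
  refine ⟨s, by exact_mod_cast hs0, fun x hx => ⟨hx.1, ?_⟩⟩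
  calc ENNReal.ofReal x ≤ ENNReal.ofReal s := ENNReal.ofReal_le_ofReal hx.2
    _ = s := ENNReal.ofReal_coe_nnreal
    _ < r := hsr

theorem IsGauge.apply_pos {r : ℝ≥0∞} {q : ℝ → ℝ} (hq : IsGauge r q) {s : ℝ}
    (hs : s ∈ gaugeDomain r) (hs0 : 0 < s) : 0 < q s := by
  have := hq.strictMonoOn ⟨le_rfl, by simpa using hq.pos⟩ hs hs0
  rwa [hq.zero] at this

/-- A regular gauge decays, along the dyadic scales `s κ 2⁻ⁿ`, at least as fast as `(n + 1)⁻³`. -/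
theorem IsRegularGauge.exists_dyadic_decay {d : ℕ} {r : ℝ≥0∞} {q : ℝ → ℝ} (hd : 1 ≤ d)
    (hq : IsRegularGauge d r q) :
    ∃ κ s₀ M : ℝ, 0 < κ ∧ κ ≤ 1 ∧ 0 < s₀ ∧ Set.Icc 0 s₀ ⊆ gaugeDomain r ∧ 0 ≤ M ∧
      ∀ s ∈ Set.Ioc 0 s₀, ∀ n : ℕ, q (s * (κ / 2 ^ n)) ≤ M / ((n : ℝ) + 1) ^ 3 * q s := by
  obtain ⟨φ, ψ, -, -, ⟨c₀, hc₀, hφψ⟩, c, hc, hint⟩ := hq.growth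
  obtain ⟨s₁, hs₁, hdom⟩ := exists_Icc_subset_gaugeDomain hq.pos
  set a := Real.log (1 + min c 1)
  have ha : 0 < a := Real.log_pos (by have := lt_min hc one_pos; linarith)
  set G : ℝ → ℝ := fun τ => |Real.log (1 + c / τ ^ (2 * d)) ^ (3 : ℝ) * (φ τ * ψ τ)|
  -- The third power of the logarithm suffices: chaining loses one factor `n + 1`, which leaves the
  -- summable `(n + 1)⁻²`.
  have hG : IntegrableOn G (Set.Ioo 0 1) := (hint 3 (by norm_num)).abs
  -- The bound `κ ≤ 1 / 2` gives `2 ^ (n + 1) * τ ≤ 1` for `τ < κ / 2 ^ n`, hence a logarithm of at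
  -- least `a * (n + 1)`, already positive at `n = 0`.
  set κ := min c₀ (1 / 2)
  have hκ : 0 < κ := lt_min hc₀ (by norm_num)
  have hκ2 : κ ≤ 1 / 2 := min_le_right _ _
  refine ⟨κ, min c₀ s₁, (∫ τ in Set.Ioo 0 1, G τ) / a ^ 3, hκ, by linarith, lt_min hc₀ hs₁,
    fun x hx => hdom ⟨hx.1, hx.2.trans (min_le_right _ _)⟩,
    div_nonneg (integral_nonneg fun _ => abs_nonneg _) (by positivity), ?_⟩
  intro s hs n
  have hsc : s ∈ Set.Ioc 0 c₀ := ⟨hs.1, hs.2.trans (min_le_left _ _)⟩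
  have hsd : ∀ τ, 0 ≤ τ → τ ≤ 1 → s * τ ∈ gaugeDomain r := fun τ h0 h1 =>
    hdom ⟨mul_nonneg hs.1.le h0,
      (mul_le_of_le_one_right hs.1.le h1).trans (hs.2.trans (min_le_right _ _))⟩
  set b := κ / 2 ^ n
  have hb : 0 < b := by positivity
  have hbκ : b ≤ κ := div_le_self hκ.le (one_le_pow₀ (by norm_num))
  have hqs : 0 < q s := by simpa using hq.apply_pos (hsd 1 (by norm_num) le_rfl) (by simpa using hs.1)
  have hcont : ContinuousOn (fun τ => q (s * τ)) (Set.Icc 0 b) :=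
    hq.continuousOn.comp (by fun_prop) fun τ hτ => hsd τ hτ.1 (by linarith [hτ.2])
  have hder : ∀ τ ∈ Set.Ioo 0 b, HasDerivWithinAt (fun τ => q (s * τ)) (deriv q (s * τ) * s)
      (Set.Ioi τ) τ := by
    intro τ hτ
    have h1 := (hq.differentiableAt (s * τ) (hsd τ hτ.1.le (by linarith [hτ.2]))
      (mul_pos hs.1 hτ.1)).hasDerivAt
    have h2 : HasDerivAt (fun τ : ℝ => s * τ) s τ := by
      simpa using (hasDerivAt_id τ).const_mul s
    exact (h1.comp τ h2).hasDerivWithinAt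
  have hGb : IntegrableOn (fun τ => q s / (a * (n + 1)) ^ 3 * G τ) (Set.Ioo 0 b) :=
    (hG.mono_set (Set.Ioo_subset_Ioo_right (by linarith))).const_mul _
  have hle : ∀ τ ∈ Set.Ioo 0 b, deriv q (s * τ) * s ≤ q s / (a * (n + 1)) ^ 3 * G τ := by
    intro τ hτ
    have hτc : τ ∈ Set.Ioc 0 c₀ := ⟨hτ.1, hτ.2.le.trans (hbκ.trans (min_le_left _ _))⟩
    obtain ⟨h1, h2⟩ := hφψ s hsc τ hτc
    have hqsτ : 0 < q (s * τ) :=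
      hq.apply_pos (hsd τ hτ.1.le (by linarith [hτ.2])) (mul_pos hs.1 hτ.1)
    have hlog : a * (n + 1) ≤ Real.log (1 + c / τ ^ (2 * d)) := by
      have hτ' : (2 : ℝ) ^ (n + 1) ≤ 1 / τ ^ (2 * d) := by
        rw [le_div_iff₀ (pow_pos hτ.1 _)]
        calc (2 : ℝ) ^ (n + 1) * τ ^ (2 * d) ≤ 2 ^ (n + 1) * τ := by
              gcongr
              exact pow_le_of_le_one hτ.1.le (by linarith [hτ.2]) (by omega)
          _ ≤ 2 ^ (n + 1) * b := by gcongr; exact hτ.2.le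
          _ = 2 * κ := by simp only [b]; field_simp; ring
          _ ≤ 1 := by linarith
      have := mul_log_one_add_min_le hc (n + 1) hτ'
      rw [mul_one_div] at this
      push_cast at this
      linarith
    have hpos : 0 < a * ((n : ℝ) + 1) := by positivity
    calc deriv q (s * τ) * s ≤ (1 / s * ψ τ * q (s * τ)) * s := by
          gcongr; exact hs.1.le
      _ = ψ τ * q (s * τ) := by field_simp [hs.1.ne']
      _ ≤ |ψ τ| * q (s * τ) := by gcongr; exact le_abs_self _
      _ ≤ |ψ τ| * (φ τ * q s) := by gcongr
      _ ≤ |ψ τ| * (|φ τ| * q s) := by gcongr; exact le_abs_self _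
      _ = q s / (a * (n + 1)) ^ 3 * ((a * (n + 1)) ^ 3 * |φ τ * ψ τ|) := by
          rw [abs_mul]; field_simp
      _ ≤ q s / (a * (n + 1)) ^ 3 * G τ := by
          simp only [G]
          rw [abs_mul (Real.log _ ^ _), abs_of_nonneg (Real.rpow_nonneg (hpos.le.trans hlog) _)]
          have : (3 : ℝ) = ((3 : ℕ) : ℝ) := by norm_num
          rw [this, Real.rpow_natCast]
          gcongr
  -- In this inequality form of the fundamental theorem only the majorant has to be integrable, not
  -- the derivative of `q`.
  have key := intervalIntegral.sub_le_integral_of_hasDeriv_right_of_le hb.le hcont hder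
    (by rwa [integrableOn_Icc_iff_integrableOn_Ioo]) hle
  simp only [mul_zero, hq.zero, sub_zero] at key
  refine key.trans ?_
  rw [intervalIntegral.integral_of_le hb.le, integral_Ioc_eq_integral_Ioo, integral_const_mul]
  have : ∫ τ in Set.Ioo 0 b, G τ ≤ ∫ τ in Set.Ioo 0 1, G τ :=
    setIntegral_mono_set hG (ae_of_all _ fun _ => abs_nonneg _)
      (Set.Ioo_subset_Ioo_right (by linarith)).eventuallyLE
  calc q s / (a * (n + 1)) ^ 3 * ∫ τ in Set.Ioo 0 b, G τ
      ≤ q s / (a * (n + 1)) ^ 3 * ∫ τ in Set.Ioo 0 1, G τ := by gcongr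
    _ = _ := by rw [mul_pow]; field_simp

/-! ### Chaining of ball averages (Garsia–Rodemich–Rumsey). -/

/-- The difference of the two averages is the average of `f x - f y` over `S × T`. -/
theorem enorm_setAverage_sub_mul_le {E F : Type*} [MeasurableSpace E] [NormedAddCommGroup F]
    [NormedSpace ℝ F] [CompleteSpace F] {μ : Measure E} {f : E → F} {S T : Set E}
    (hS0 : μ S ≠ 0) (hS : μ S ≠ ∞) (hT0 : μ T ≠ 0) (hT : μ T ≠ ∞) (hfS : IntegrableOn f S μ)
    (hfT : IntegrableOn f T μ) :
    ‖(⨍ x in S, f x ∂μ) - ⨍ x in T, f x ∂μ‖ₑ * (μ S * μ T) ≤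
      ∫⁻ x in S, ∫⁻ y in T, ‖f x - f y‖ₑ ∂μ ∂μ := by
  have hinner : ∀ x, ∫ y in T, (f x - f y) ∂μ = μ.real T • f x - ∫ y in T, f y ∂μ := by
    intro x
    have : IsFiniteMeasure (μ.restrict T) := ⟨by simpa using hT.lt_top⟩
    rw [integral_sub (integrable_const _) hfT]
    simp [measureReal_def]
  have houter : ∫ x in S, ∫ y in T, (f x - f y) ∂μ ∂μ =
      (μ.real S * μ.real T) • ((⨍ x in S, f x ∂μ) - ⨍ x in T, f x ∂μ) := by
    have : IsFiniteMeasure (μ.restrict S) := ⟨by simpa using hS.lt_top⟩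
    have h1 : μ.real S ≠ 0 := by simp [measureReal_def, ENNReal.toReal_eq_zero_iff, hS0, hS]
    have h2 : μ.real T ≠ 0 := by simp [measureReal_def, ENNReal.toReal_eq_zero_iff, hT0, hT]
    simp_rw [hinner]
    rw [integral_sub (f := fun x => μ.real T • f x) (hfS.smul _) (integrable_const _),
      integral_smul, setAverage_eq,
      setAverage_eq, smul_sub, smul_smul, smul_smul]
    simp only [integral_const, measureReal_restrict_apply_univ]
    congr 2
    · field_simp
    · field_simp
  have henorm : ‖μ.real S * μ.real T‖ₑ = μ S * μ T := by
    rw [enorm_mul, Real.enorm_eq_ofReal measureReal_nonneg, Real.enorm_eq_ofReal measureReal_nonneg,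
      ofReal_measureReal hS, ofReal_measureReal hT]
  calc _ = ‖∫ x in S, ∫ y in T, (f x - f y) ∂μ ∂μ‖ₑ := by
        rw [houter, enorm_smul, henorm, mul_comm]
    _ ≤ ∫⁻ x in S, ‖∫ y in T, (f x - f y) ∂μ‖ₑ ∂μ := enorm_integral_le_lintegral_enorm _
    _ ≤ _ := lintegral_mono fun x => enorm_integral_le_lintegral_enorm _

/-- Tangent line of `exp` at `log A`. After averaging it acts as Jensen's inequality: if `exp x` has
mean at most `A`, then `x` has mean at most `log A`. -/
theorem le_log_sub_one_add_exp_div {A x : ℝ} (hA : 0 < A) :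
    x ≤ Real.log A - 1 + Real.exp x / A := by
  have := Real.add_one_le_exp (x - Real.log A)
  rw [Real.exp_sub, Real.exp_log hA] at this
  linarith

/-- The averages of `f` over `S` and `T` differ by at most `Q log A`, if `Q` bounds the gauge of
the distances between `S` and `T` and `A` bounds the normalized exponential energy on `S × T`. -/
theorem norm_setAverage_sub_le {E F : Type*} [NormedAddCommGroup E] [MeasurableSpace E]
    [NormedAddCommGroup F] [NormedSpace ℝ F] [CompleteSpace F] {μ : Measure E} {f : E → F}
    {q : ℝ → ℝ} {S T : Set E} {Q A : ℝ} (hSm : MeasurableSet S) (hTm : MeasurableSet T)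
    (hS0 : μ S ≠ 0) (hS : μ S ≠ ∞) (hT0 : μ T ≠ 0) (hT : μ T ≠ ∞)
    (hfS : IntegrableOn f S μ) (hfT : IntegrableOn f T μ) (hQ0 : 0 ≤ Q)
    (hQ : ∀ x ∈ S, ∀ y ∈ T, x ≠ y → 0 < q ‖x - y‖ ∧ q ‖x - y‖ ≤ Q) (hA : Real.exp 1 ≤ A)
    (hexp : ∫⁻ x in S, ∫⁻ y in T,
      ENNReal.ofReal (Real.exp (‖f x - f y‖ / q ‖x - y‖)) ∂μ ∂μ ≤ ENNReal.ofReal A * (μ S * μ T)) :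
    ‖(⨍ x in S, f x ∂μ) - ⨍ x in T, f x ∂μ‖ ≤ Q * Real.log A := by
  have hA0 : 0 < A := (Real.exp_pos 1).trans_le hA
  have hlog : 1 ≤ Real.log A := (Real.le_log_iff_exp_le hA0).2 hA
  have hpt : ∀ x ∈ S, ∀ y ∈ T, ‖f x - f y‖ₑ ≤ ENNReal.ofReal (Q * (Real.log A - 1)) +
      ENNReal.ofReal (Q / A) * ENNReal.ofReal (Real.exp (‖f x - f y‖ / q ‖x - y‖)) := by
    intro x hx y hy
    rw [← ENNReal.ofReal_mul (by positivity), ← ENNReal.ofReal_add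
      (mul_nonneg hQ0 (by linarith)) (by positivity), ← ofReal_norm]
    apply ENNReal.ofReal_le_ofReal
    rcases eq_or_ne x y with rfl | hxy
    · simp only [sub_self, norm_zero]
      have := mul_nonneg hQ0 (by linarith : 0 ≤ Real.log A - 1)
      positivity
    · obtain ⟨h0, h1⟩ := hQ x hx y hy hxy
      calc ‖f x - f y‖ = q ‖x - y‖ * (‖f x - f y‖ / q ‖x - y‖) := by field_simp
        _ ≤ Q * (‖f x - f y‖ / q ‖x - y‖) := by gcongr
        _ ≤ Q * (Real.log A - 1 + Real.exp (‖f x - f y‖ / q ‖x - y‖) / A) := by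
            gcongr; exact le_log_sub_one_add_exp_div hA0
        _ = _ := by ring
  have hv0 : μ S * μ T ≠ 0 := mul_ne_zero hS0 hT0
  have hv : μ S * μ T ≠ ∞ := ENNReal.mul_ne_top hS hT
  have hmain : ‖(⨍ x in S, f x ∂μ) - ⨍ x in T, f x ∂μ‖ₑ * (μ S * μ T) ≤
      ENNReal.ofReal (Q * Real.log A) * (μ S * μ T) := by
    calc _ ≤ ∫⁻ x in S, ∫⁻ y in T, ‖f x - f y‖ₑ ∂μ ∂μ :=
          enorm_setAverage_sub_mul_le hS0 hS hT0 hT hfS hfT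
      _ ≤ ∫⁻ x in S, ∫⁻ y in T, (ENNReal.ofReal (Q * (Real.log A - 1)) + ENNReal.ofReal (Q / A) *
          ENNReal.ofReal (Real.exp (‖f x - f y‖ / q ‖x - y‖))) ∂μ ∂μ :=
          setLIntegral_mono' hSm fun x hx => setLIntegral_mono' hTm fun y hy => hpt x hx y hy
      _ = ENNReal.ofReal (Q * (Real.log A - 1)) * (μ S * μ T) + ENNReal.ofReal (Q / A) *
          ∫⁻ x in S, ∫⁻ y in T, ENNReal.ofReal (Real.exp (‖f x - f y‖ / q ‖x - y‖)) ∂μ ∂μ := by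
          simp_rw [lintegral_add_left measurable_const,
            lintegral_const_mul' _ _ ENNReal.ofReal_ne_top]
          simp only [lintegral_const, Measure.restrict_apply_univ]
          ring
      _ ≤ ENNReal.ofReal (Q * (Real.log A - 1)) * (μ S * μ T) + ENNReal.ofReal (Q / A) *
          (ENNReal.ofReal A * (μ S * μ T)) := by gcongr
      _ = _ := by
          rw [← mul_assoc (ENNReal.ofReal (Q / A)), ← ENNReal.ofReal_mul (by positivity), ← add_mul,
            ← ENNReal.ofReal_add (mul_nonneg hQ0 (by linarith)) (by positivity)]
          congr 2
          field_simp
          ring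
  rw [ENNReal.mul_le_mul_iff_left hv0 hv, ← ofReal_norm] at hmain
  exact (ENNReal.ofReal_le_ofReal_iff (mul_nonneg hQ0 (by linarith))).1 hmain

theorem sum_range_inv_succ_sq_le (n : ℕ) :
    ∑ k ∈ Finset.range n, 1 / ((k : ℝ) + 1) ^ 2 ≤ 2 := by
  -- The sharper bound telescopes, since `1 / (m + 1)² ≤ 2 / (m + 1) - 2 / (m + 2)`.
  suffices h : ∑ k ∈ Finset.range n, 1 / ((k : ℝ) + 1) ^ 2 ≤ 2 - 2 / ((n : ℝ) + 1) by
    have : 0 ≤ 2 / ((n : ℝ) + 1) := by positivity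
    linarith
  induction n with
  | zero => norm_num
  | succ m ih =>
    rw [Finset.sum_range_succ]
    have : 1 / ((m : ℝ) + 1) ^ 2 ≤ 2 / ((m : ℝ) + 1) - 2 / ((m : ℝ) + 1 + 1) := by
      rw [div_sub_div _ _ (by positivity) (by positivity), div_le_div_iff₀ (by positivity)
        (by positivity)]
      have hm : (0 : ℝ) ≤ m := Nat.cast_nonneg m
      nlinarith [mul_nonneg hm hm, mul_nonneg hm (mul_nonneg hm hm)]
    push_cast
    linarith

theorem tendsto_setAverage_ball {E F : Type*} [NormedAddCommGroup E] [MeasurableSpace E]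
    [NormedAddCommGroup F] [NormedSpace ℝ F] [CompleteSpace F] {μ : Measure E}
    [IsLocallyFiniteMeasure μ] [ProperSpace E] [BorelSpace E]
    [μ.IsOpenPosMeasure] {f : E → F} (hf : Continuous f) (t : E) {ρ : ℕ → ℝ}
    (hρ0 : ∀ n, 0 < ρ n) (hρ : Filter.Tendsto ρ Filter.atTop (nhds 0)) :
    Filter.Tendsto (fun n => ⨍ x in Metric.ball t (ρ n), f x ∂μ) Filter.atTop (nhds (f t)) := by
  rw [Metric.tendsto_atTop']
  intro ε hε
  obtain ⟨δ, hδ, hball⟩ := Metric.continuousAt_iff.1 hf.continuousAt (ε / 2) (half_pos hε)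
  obtain ⟨N, hN⟩ := Filter.eventually_atTop.1 (hρ.eventually (gt_mem_nhds hδ))
  refine ⟨N, fun n hn => ?_⟩
  have hmem : (⨍ x in Metric.ball t (ρ n), f x ∂μ) ∈ Metric.closedBall (f t) (ε / 2) := by
    refine (convex_closedBall (f t) (ε / 2)).set_average_mem Metric.isClosed_closedBall
      (Metric.measure_ball_pos _ _ (hρ0 n)).ne' measure_ball_lt_top.ne ?_
      ((hf.locallyIntegrable.integrableOn_isCompact (isCompact_closedBall t (ρ n))).mono_set
        Metric.ball_subset_closedBall)
    filter_upwards [ae_restrict_mem measurableSet_ball] with x hx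
    exact (hball (lt_trans hx (hN n hn.le))).le
  exact lt_of_le_of_lt hmem (by linarith)

theorem log_four_le_two : Real.log 4 ≤ 2 := by
  have : (4 : ℝ) = 2 ^ 2 := by norm_num
  rw [this, Real.log_pow]
  have := Real.log_two_lt_d9
  push_cast
  linarith

/-- Lets the squared oscillation, which is quadratic in the logarithm of the energy, be bounded
linearly in the energy, whose mean is controlled. -/
theorem sq_log_le {x : ℝ} (hx : 1 ≤ x) : Real.log x ^ 2 ≤ 4 * x := by
  have h0 : 0 ≤ x := by linarith
  have h1 : Real.log x ≤ 2 * √x := by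
    have := Real.log_le_sub_one_of_pos (Real.sqrt_pos.2 (by linarith : 0 < x))
    rw [Real.log_sqrt h0] at this
    linarith
  calc Real.log x ^ 2 ≤ (2 * √x) ^ 2 := by gcongr; exact Real.log_nonneg hx
    _ = 4 * x := by rw [mul_pow, Real.sq_sqrt h0]; norm_num

theorem volume_ball_eq_ofReal {d : ℕ} (x : EuclideanSpace ℝ (Fin d)) {ρ : ℝ} (hρ : 0 < ρ) :
    volume (Metric.ball x ρ) = ENNReal.ofReal (ρ ^ d *
      volume.real (Metric.ball (0 : EuclideanSpace ℝ (Fin d)) 1)) := by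
  rw [Measure.addHaar_ball_of_pos _ _ hρ, finrank_euclideanSpace_fin, ENNReal.ofReal_mul
    (by positivity), ofReal_measureReal measure_ball_lt_top.ne]

theorem volumeReal_unitBall_pos (d : ℕ) :
    0 < volume.real (Metric.ball (0 : EuclideanSpace ℝ (Fin d)) 1) :=
  ENNReal.toReal_pos (Metric.measure_ball_pos _ _ one_pos).ne' measure_ball_lt_top.ne

/-- A bound of Garsia–Rodemich–Rumsey type: the exponential energy `∫∫ exp (|f x - f y| / q |x - y|)`
on a ball controls the oscillation of `f` on the concentric ball of half the radius. -/
theorem norm_sub_le_of_exp_energy {d : ℕ} {r : ℝ≥0∞} {q : ℝ → ℝ} (hq : IsGauge r q)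
    {κ s₀ M : ℝ} (hκ : 0 < κ) (hκ1 : κ ≤ 1) (hdom : Set.Icc 0 s₀ ⊆ gaugeDomain r) (hM : 0 ≤ M)
    {F : Type*} [NormedAddCommGroup F] [NormedSpace ℝ F] [CompleteSpace F]
    {f : EuclideanSpace ℝ (Fin d) → F} (hf : Continuous f) {s ρ β : ℝ} (hs : s ∈ Set.Ioc 0 s₀)
    (hρ : 4 * ρ = s * κ)
    (hdecay : ∀ n : ℕ, q (s * (κ / 2 ^ n)) ≤ M / ((n : ℝ) + 1) ^ 3 * q s)
    (hβ : Real.exp 1 ≤ β) (t₀ : EuclideanSpace ℝ (Fin d))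
    (hB : ∫⁻ x in Metric.ball t₀ (2 * ρ), ∫⁻ y in Metric.ball t₀ (2 * ρ),
      ENNReal.ofReal (Real.exp (‖f x - f y‖ / q ‖x - y‖)) ≤
      ENNReal.ofReal (β * (ρ ^ d * volume.real (Metric.ball (0 : EuclideanSpace ℝ (Fin d)) 1)) ^ 2))
    {t : EuclideanSpace ℝ (Fin d)} (ht : t ∈ Metric.ball t₀ ρ) :
    ‖f t - f t₀‖ ≤ 6 * (M * q s * (Real.log β + 2 * d)) := by
  set ω := volume.real (Metric.ball (0 : EuclideanSpace ℝ (Fin d)) 1)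
  have hω : 0 < ω := volumeReal_unitBall_pos d
  have hρ0 : 0 < ρ := by have := mul_pos hs.1 hκ; linarith
  have hβ0 : 0 < β := (Real.exp_pos 1).trans_le hβ
  have hlogβ : 1 ≤ Real.log β := (Real.le_log_iff_exp_le hβ0).2 hβ
  have hsκ : ∀ n : ℕ, s * (κ / 2 ^ n) = 4 * (ρ / 2 ^ n) := fun n => by
    rw [← mul_div_assoc, ← hρ, mul_div_assoc]
  have hdom' : ∀ u, 0 ≤ u → u ≤ 4 * ρ → u ∈ gaugeDomain r := fun u h0 h1 =>
    hdom ⟨h0, by nlinarith [hs.1, hs.2]⟩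
  have hqs : 0 < q s := hq.apply_pos (hdom ⟨hs.1.le, hs.2⟩) hs.1
  set L := M * q s * (Real.log β + 2 * d)
  have hL : 0 ≤ L := by positivity
  have hint : ∀ x R, IntegrableOn f (Metric.ball x R) volume := fun x R =>
    (hf.locallyIntegrable.integrableOn_isCompact (isCompact_closedBall x R)).mono_set
        Metric.ball_subset_closedBall
  -- One link of the chain at level `n`. Points of the two balls are within `4 * (ρ / 2 ^ n) = s *
  -- (κ / 2 ^ n)`, where the gauge is at most `M / (n + 1) ^ 3 * q s`. Normalizing the energy by the
  -- volumes of balls of radius `ρ / 2 ^ (n + 1)` costs `4 ^ (d * (n + 1))`, whose logarithm is at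
  -- most `2 * d * (n + 1)`.
  have link : ∀ (n : ℕ) (x y : EuclideanSpace ℝ (Fin d)) (R R' : ℝ), ρ / 2 ^ (n + 1) ≤ R →
      ρ / 2 ^ (n + 1) ≤ R' → Metric.ball x R ⊆ Metric.ball t₀ (2 * ρ) →
      Metric.ball y R' ⊆ Metric.ball t₀ (2 * ρ) → R + dist x y + R' ≤ 4 * (ρ / 2 ^ n) →
      dist (⨍ z in Metric.ball x R, f z) (⨍ z in Metric.ball y R', f z) ≤
        L * (1 / ((n : ℝ) + 1) ^ 2) := by
    intro n x y R R' hR hR' hsub hsub' hdist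
    have hρn : 0 < ρ / 2 ^ (n + 1) := by positivity
    have hR0 : 0 < R := hρn.trans_le hR
    have hR0' : 0 < R' := hρn.trans_le hR'
    have hρn4 : 4 * (ρ / 2 ^ n) ≤ 4 * ρ := by
      gcongr; exact div_le_self hρ0.le (one_le_pow₀ (by norm_num))
    have hA : β ≤ β * 4 ^ (d * (n + 1)) :=
      le_mul_of_one_le_right hβ0.le (one_le_pow₀ (by norm_num))
    have hQ : q (4 * (ρ / 2 ^ n)) ≤ M / ((n : ℝ) + 1) ^ 3 * q s := by
      rw [← hsκ]; exact hdecay n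
    have hQ0 : 0 ≤ M / ((n : ℝ) + 1) ^ 3 * q s := by positivity
    rw [dist_eq_norm]
    have hmain := norm_setAverage_sub_le (μ := volume) (f := f) (q := q)
      (S := Metric.ball x R) (T := Metric.ball y R') (Q := M / ((n : ℝ) + 1) ^ 3 * q s)
      (A := β * 4 ^ (d * (n + 1)))
      measurableSet_ball measurableSet_ball (Metric.measure_ball_pos _ _ hR0).ne'
      measure_ball_lt_top.ne (Metric.measure_ball_pos _ _ hR0').ne' measure_ball_lt_top.ne
      (hint _ _) (hint _ _) hQ0 ?_ (hβ.trans hA) ?_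
    · refine hmain.trans ?_
      have hlog : Real.log (β * 4 ^ (d * (n + 1))) ≤ (Real.log β + 2 * d) * (n + 1) := by
        rw [Real.log_mul hβ0.ne' (by positivity), Real.log_pow]
        push_cast
        have h1 : (d : ℝ) * (n + 1) * Real.log 4 ≤ d * (n + 1) * 2 := by
          gcongr; exact log_four_le_two
        have h2 : Real.log β ≤ Real.log β * (n + 1) :=
          le_mul_of_one_le_right (by linarith) (by linarith [Nat.cast_nonneg (α := ℝ) n])
        linarith
      calc _ ≤ M / ((n : ℝ) + 1) ^ 3 * q s * ((Real.log β + 2 * d) * (n + 1)) := by gcongr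
        _ = _ := by simp only [L]; field_simp
    · intro u hu v hv huv
      have h0 : 0 < ‖u - v‖ := norm_pos_iff.2 (sub_ne_zero.2 huv)
      have h1 : ‖u - v‖ ≤ 4 * (ρ / 2 ^ n) := by
        rw [← dist_eq_norm]
        have h2 := dist_triangle4 u x y v
        rw [Metric.mem_ball] at hu hv
        rw [dist_comm y v] at h2
        linarith
      refine ⟨hq.apply_pos (hdom' _ h0.le (h1.trans hρn4)) h0, le_trans ?_ hQ⟩
      exact hq.strictMonoOn.monotoneOn (hdom' _ h0.le (h1.trans hρn4))
        (hdom' _ (by positivity) hρn4) h1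
    · calc _ ≤ ∫⁻ x in Metric.ball t₀ (2 * ρ), ∫⁻ y in Metric.ball t₀ (2 * ρ),
            ENNReal.ofReal (Real.exp (‖f x - f y‖ / q ‖x - y‖)) :=
            (lintegral_mono_set hsub).trans (lintegral_mono fun _ => lintegral_mono_set hsub')
        _ ≤ _ := hB
        _ ≤ ENNReal.ofReal (β * 4 ^ (d * (n + 1))) *
            (volume (Metric.ball x (ρ / 2 ^ (n + 1))) *
              volume (Metric.ball y (ρ / 2 ^ (n + 1)))) := by
            rw [volume_ball_eq_ofReal _ hρn, volume_ball_eq_ofReal _ hρn,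
              ← ENNReal.ofReal_mul (by positivity), ← ENNReal.ofReal_mul (by positivity)]
            apply ENNReal.ofReal_le_ofReal
            apply le_of_eq
            have h4 : (4 : ℝ) ^ (d * (n + 1)) = ((2 ^ (n + 1)) ^ d) ^ 2 := by
              rw [show (4 : ℝ) = 2 ^ 2 by norm_num, ← pow_mul, ← pow_mul, ← pow_mul]
              congr 1; ring
            rw [h4, div_pow]
            field_simp
            rfl
        _ ≤ _ := by
            gcongr
  set a : ℕ → EuclideanSpace ℝ (Fin d) → F := fun n t => ⨍ z in Metric.ball t (ρ / 2 ^ n), f z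
  have hsub : ∀ (t : EuclideanSpace ℝ (Fin d)) (n : ℕ), t ∈ Metric.ball t₀ ρ →
      Metric.ball t (ρ / 2 ^ n) ⊆ Metric.ball t₀ (2 * ρ) := by
    intro t n ht
    apply Metric.ball_subset_ball'
    have : ρ / 2 ^ n ≤ ρ := div_le_self hρ0.le (one_le_pow₀ (by norm_num))
    rw [Metric.mem_ball] at ht
    linarith
  have ht₀ : t₀ ∈ Metric.ball t₀ ρ := Metric.mem_ball_self hρ0
  -- One link moves the centre from `t₀` to `t` at full radius, at cost `L`; then the radius shrinks
  -- to zero at `t`, at cost `2 * L`.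
  have hchain : ∀ t ∈ Metric.ball t₀ ρ, dist (f t) (a 0 t₀) ≤ 3 * L := by
    intro t ht
    have h0 : dist (a 0 t) (a 0 t₀) ≤ L := by
      have := link 0 t t₀ (ρ / 2 ^ 0) (ρ / 2 ^ 0) (by simp; linarith) (by simp; linarith)
        (hsub t 0 ht) (hsub t₀ 0 ht₀) (by rw [Metric.mem_ball] at ht; simp; linarith)
      simpa [a] using this
    have hn : ∀ n, dist (a 0 t) (a n t) ≤ 2 * L := by
      intro n
      calc dist (a 0 t) (a n t) ≤ ∑ k ∈ Finset.range n, dist (a k t) (a (k + 1) t) :=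
            dist_le_range_sum_dist (fun k => a k t) n
        _ ≤ ∑ k ∈ Finset.range n, L * (1 / ((k : ℝ) + 1) ^ 2) := by
            refine Finset.sum_le_sum fun k _ => ?_
            have hk : ρ / 2 ^ (k + 1) = ρ / 2 ^ k / 2 := by rw [pow_succ, div_div]
            have hk0 : 0 < ρ / 2 ^ k := by positivity
            refine link k t t _ _ ?_ le_rfl (hsub t k ht) (hsub t (k + 1) ht) ?_
            · linarith
            · rw [dist_self]; linarith
        _ = L * ∑ k ∈ Finset.range n, 1 / ((k : ℝ) + 1) ^ 2 := by rw [Finset.mul_sum]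
        _ ≤ L * 2 := by gcongr; exact sum_range_inv_succ_sq_le n
        _ = 2 * L := mul_comm _ _
    have hlim : Filter.Tendsto (fun n => a n t) Filter.atTop (nhds (f t)) :=
      tendsto_setAverage_ball hf t (fun n => by positivity) (by
        have := (tendsto_pow_atTop_nhds_zero_of_lt_one (r := (1 / 2 : ℝ)) (by norm_num)
          (by norm_num)).const_mul ρ
        simpa [div_eq_mul_inv] using this)
    have h2 : dist (a 0 t) (f t) ≤ 2 * L :=
      le_of_tendsto (tendsto_const_nhds.dist hlim) (Filter.Eventually.of_forall hn)
    calc dist (f t) (a 0 t₀) ≤ dist (f t) (a 0 t) + dist (a 0 t) (a 0 t₀) := dist_triangle _ _ _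
      _ ≤ 2 * L + L := by rw [dist_comm]; gcongr
      _ = 3 * L := by ring
  rw [← dist_eq_norm]
  calc dist (f t) (f t₀) ≤ dist (f t) (a 0 t₀) + dist (f t₀) (a 0 t₀) := dist_triangle_right _ _ _
    _ ≤ 3 * L + 3 * L := add_le_add (hchain t ht) (hchain t₀ ht₀)
    _ = 6 * L := by ring

/-- The Garsia–Rodemich–Rumsey bound for a regular gauge at scale `s`, in squared form. -/
theorem IsRegularGauge.exists_enorm_sub_sq_le {d : ℕ} {r : ℝ≥0∞} {q : ℝ → ℝ} (hd : 1 ≤ d)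
    (hq : IsRegularGauge d r q) (F : Type*) [NormedAddCommGroup F] [NormedSpace ℝ F]
    [CompleteSpace F] :
    ∃ κ s₀ C : ℝ, 0 < κ ∧ 0 < s₀ ∧ 0 < C ∧ Set.Icc 0 s₀ ⊆ gaugeDomain r ∧
      ∀ s ∈ Set.Ioc 0 s₀, ∀ f : EuclideanSpace ℝ (Fin d) → F, Continuous f →
        ∀ t₀, ∀ t ∈ Metric.ball t₀ (κ * s),
          ‖f t - f t₀‖ₑ ^ 2 ≤ ENNReal.ofReal (C * q s ^ 2) *
            (1 + (∫⁻ x in Metric.ball t₀ (2 * (κ * s)), ∫⁻ y in Metric.ball t₀ (2 * (κ * s)),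
              ENNReal.ofReal (Real.exp (‖f x - f y‖ / q ‖x - y‖))) /
              ENNReal.ofReal ((κ * s) ^ (2 * d))) := by
  obtain ⟨κ, s₀, M, hκ, hκ1, hs₀, hdom, hM, hdecay⟩ := hq.exists_dyadic_decay hd
  set ω := volume.real (Metric.ball (0 : EuclideanSpace ℝ (Fin d)) 1)
  have hω : 0 < ω := volumeReal_unitBall_pos d
  -- Here `288 = 6² * 8`, the `8` coming from `(log β + 2 d)² ≤ 2 log² β + 8 d² ≤ 8 (β + d²)`. The
  -- `+ 1` keeps the constant positive if `M = 0`, so that the right-hand side is infinite when the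
  -- energy is.
  refine ⟨κ / 4, s₀, 288 * M ^ 2 * (Real.exp 1 + d ^ 2 + 1 / ω ^ 2) + 1, by positivity, hs₀,
    by positivity, hdom, ?_⟩
  intro s hs f hf t₀ t ht
  set ρ := κ / 4 * s
  have hρ0 : 0 < ρ := mul_pos (by positivity) hs.1
  have hqs : 0 < q s := hq.apply_pos (hdom ⟨hs.1.le, hs.2⟩) hs.1
  set B := ∫⁻ x in Metric.ball t₀ (2 * ρ), ∫⁻ y in Metric.ball t₀ (2 * ρ),
              ENNReal.ofReal (Real.exp (‖f x - f y‖ / q ‖x - y‖)) with hBdef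
  set C := 288 * M ^ 2 * (Real.exp 1 + d ^ 2 + 1 / ω ^ 2) + 1
  have hC : 0 < C := by positivity
  rcases eq_or_ne B ∞ with hB | hB
  · rw [hB, ENNReal.top_div_of_ne_top ENNReal.ofReal_ne_top, add_top, ENNReal.mul_top]
    · exact le_top
    · simpa using by positivity
  set b := B.toReal
  have hb : 0 ≤ b := ENNReal.toReal_nonneg
  have hBb : B = ENNReal.ofReal b := (ENNReal.ofReal_toReal hB).symm
  -- The normalized energy, shifted by `e` so that `log β ≥ 1`.
  set β := Real.exp 1 + b / (ρ ^ d * ω) ^ 2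
  have hβ : Real.exp 1 ≤ β := le_add_of_nonneg_right (by positivity)
  have hβ1 : 1 ≤ β := (Real.one_le_exp (by norm_num)).trans hβ
  have hmain := norm_sub_le_of_exp_energy (β := β) hq.toIsGauge hκ hκ1 hdom hM hf hs
    (ρ := ρ) (by simp only [ρ]; ring) (hdecay s hs) hβ t₀ (by
      rw [← hBdef, hBb]
      apply ENNReal.ofReal_le_ofReal
      have : β * (ρ ^ d * ω) ^ 2 = Real.exp 1 * (ρ ^ d * ω) ^ 2 + b := by
        simp only [β]; field_simp
      change b ≤ β * (ρ ^ d * ω) ^ 2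
      rw [this]
      exact le_add_of_nonneg_left (by positivity)) ht
  rw [hBb, ← ENNReal.ofReal_div_of_pos (by positivity), ← ENNReal.ofReal_one,
    ← ENNReal.ofReal_add one_pos.le (by positivity), ← ENNReal.ofReal_mul (by positivity),
    ← ofReal_norm, ← ENNReal.ofReal_pow (norm_nonneg _)]
  apply ENNReal.ofReal_le_ofReal
  have hlogβ : 0 ≤ Real.log β := Real.log_nonneg hβ1
  calc ‖f t - f t₀‖ ^ 2 ≤ (6 * (M * q s * (Real.log β + 2 * d))) ^ 2 := by gcongr
    _ = 36 * M ^ 2 * q s ^ 2 * (Real.log β + 2 * d) ^ 2 := by ring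
    _ ≤ 36 * M ^ 2 * q s ^ 2 * (8 * (β + d ^ 2)) := by
        gcongr
        nlinarith [sq_log_le hβ1, sq_nonneg (Real.log β - 2 * d)]
    _ = 288 * M ^ 2 * (Real.exp 1 + d ^ 2 + 1 / ω ^ 2 * (b / ρ ^ (2 * d))) * q s ^ 2 := by
        simp only [β]
        rw [mul_pow, ← pow_mul, mul_comm d 2]
        field_simp
        ring
    _ ≤ C * q s ^ 2 * (1 + b / ρ ^ (2 * d)) := by
        have h1 : 0 ≤ b / ρ ^ (2 * d) := by positivity
        have h2 : Real.exp 1 + d ^ 2 + 1 / ω ^ 2 * (b / ρ ^ (2 * d)) ≤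
            (Real.exp 1 + d ^ 2 + 1 / ω ^ 2) * (1 + b / ρ ^ (2 * d)) := by
          have h3 : 0 ≤ 1 / ω ^ 2 := by positivity
          have h4 : 0 ≤ Real.exp 1 + (d : ℝ) ^ 2 := by positivity
          nlinarith [mul_nonneg h4 h1]
        calc _ ≤ 288 * M ^ 2 * ((Real.exp 1 + d ^ 2 + 1 / ω ^ 2) * (1 + b / ρ ^ (2 * d))) *
              q s ^ 2 := by gcongr
          _ = (C - 1) * q s ^ 2 * (1 + b / ρ ^ (2 * d)) := by simp only [C]; ring
          _ ≤ _ := by gcongr; linarith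

/-! ### Hitting probabilities of a real Gaussian process. -/

theorem gaussianPDFReal_le_inv_sqrt (m : ℝ) (v : NNReal) (x : ℝ) :
    gaussianPDFReal m v x ≤ (√v)⁻¹ := by
  rcases eq_or_ne v 0 with rfl | hv
  · simp
  have hv0 : (0 : ℝ) < v := by positivity
  rw [gaussianPDFReal]
  calc _ ≤ (√(2 * Real.pi * v))⁻¹ * 1 := by
        gcongr
        rw [Real.exp_le_one_iff]
        exact div_nonpos_of_nonpos_of_nonneg (neg_nonpos.2 (sq_nonneg _)) (by positivity)
    _ ≤ (√v)⁻¹ := by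
        rw [mul_one]
        gcongr
        nlinarith [Real.pi_gt_three]

/-- With `a = √(2 v)` and `y = |x - m|`, one has `y ≤ a * exp (y² / a²)`. The bound is scale
invariant, so it controls neighbourhoods whose size is proportional to the distance from the mean,
uniformly in `m` and `v`. -/
theorem gaussianPDFReal_mul_abs_le_one (m : ℝ) (v : NNReal) (x : ℝ) :
    gaussianPDFReal m v x * |x - m| ≤ 1 := by
  rcases eq_or_ne v 0 with rfl | hv
  · simp
  have hv0 : (0 : ℝ) < v := by positivity
  have ha : 0 < √(2 * v) := Real.sqrt_pos.2 (by positivity)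
  have ha2 : √(2 * v) ^ 2 = 2 * v := Real.sq_sqrt (by positivity)
  set a := √(2 * (v : ℝ))
  have hy : |x - m| ^ 2 = (x - m) ^ 2 := sq_abs _
  set y := |x - m|
  have hy0 : 0 ≤ y := abs_nonneg _
  have hexp : 1 + y ^ 2 / a ^ 2 ≤ Real.exp (y ^ 2 / a ^ 2) := by
    linarith [Real.add_one_le_exp (y ^ 2 / a ^ 2)]
  have hsqrt : a ≤ √(2 * Real.pi * v) := by
    apply Real.sqrt_le_sqrt
    nlinarith [Real.pi_gt_three]
  have hle : y ≤ √(2 * Real.pi * v) * Real.exp (y ^ 2 / a ^ 2) := by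
    calc y ≤ a * (1 + y ^ 2 / a ^ 2) := by
          have : a * (1 + y ^ 2 / a ^ 2) = (a ^ 2 + y ^ 2) / a := by field_simp
          rw [this, le_div_iff₀ ha]
          nlinarith [sq_nonneg (a - y)]
      _ ≤ _ := by gcongr
  rw [gaussianPDFReal, neg_div, Real.exp_neg, ← hy, ← ha2, ← mul_inv, inv_mul_eq_div]
  exact div_le_one_of_le₀ hle (by positivity)

theorem gaussianReal_le_inv_sqrt_mul_volume (m : ℝ) {v : NNReal} (hv : v ≠ 0) (s : Set ℝ) :
    gaussianReal m v s ≤ ENNReal.ofReal (√v)⁻¹ * volume s := by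
  rw [gaussianReal_apply m hv, ← setLIntegral_const]
  exact lintegral_mono fun x => ENNReal.ofReal_le_ofReal (gaussianPDFReal_le_inv_sqrt m v x)

/-- The Gaussian mass of a multiplicative neighbourhood of a point, seen from the mean, is bounded
by the relative size of the neighbourhood. -/
theorem gaussianReal_abs_sub_le_mul_abs_le (m : ℝ) {v : NNReal} (hv : v ≠ 0) (z : ℝ) {b : ℝ}
    (hb0 : 0 ≤ b) (hb : b ≤ 1 / 8) :
    gaussianReal m v {x | |x - z| ≤ 2 * b * |x - m|} ≤ ENNReal.ofReal (12 * b) := by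
  set w := |z - m|
  -- Since `2 * b ≤ 1 / 4`, the distances of `x` and `z` to the mean are comparable. The set thus
  -- lies within `4 * b * w` of `z` and the density on it is at most `3 / (2 * w)`, whence the mass
  -- `12 * b`.
  have hxw : ∀ x, |x - z| ≤ 2 * b * |x - m| → 2 * w ≤ 3 * |x - m| ∧ |x - m| ≤ 2 * w := by
    intro x hx
    have h1 : w ≤ |x - z| + |x - m| := by
      have := abs_sub_le z x m; rw [abs_sub_comm z x] at this; exact this
    have h2 : |x - m| ≤ |x - z| + w := abs_sub_le x z m
    have h3 : 2 * b * |x - m| ≤ 1 / 4 * |x - m| := by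
      gcongr; linarith
    have h4 : 0 ≤ |x - m| := abs_nonneg _
    constructor <;> linarith
  rcases (abs_nonneg (z - m)).eq_or_lt with hw | hw
  · have hsub : {x | |x - z| ≤ 2 * b * |x - m|} ⊆ {m} := by
      intro x hx
      have h1 : |x - m| ≤ 2 * |z - m| := (hxw x hx).2
      rw [← hw, mul_zero] at h1
      exact sub_eq_zero.1 (abs_eq_zero.1 (le_antisymm h1 (abs_nonneg _)))
    have : NullSingletonClass (gaussianReal m v) := nullSingletonClass_gaussianReal hv
    calc _ ≤ gaussianReal m v {m} := measure_mono hsub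
      _ = 0 := measure_singleton m
      _ ≤ _ := zero_le
  · change 0 < w at hw
    have hsub : {x | |x - z| ≤ 2 * b * |x - m|} ⊆ Metric.closedBall z (4 * b * w) := by
      intro x hx
      rw [Metric.mem_closedBall, Real.dist_eq]
      have h1 : |x - z| ≤ 2 * b * |x - m| := hx
      calc |x - z| ≤ 2 * b * |x - m| := h1
        _ ≤ 2 * b * (2 * w) := by gcongr; exact (hxw x hx).2
        _ = _ := by ring
    have hmeas : MeasurableSet {x : ℝ | |x - z| ≤ 2 * b * |x - m|} :=
      measurableSet_le (by fun_prop) (by fun_prop)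
    rw [gaussianReal_apply m hv]
    calc _ ≤ ∫⁻ x in {x | |x - z| ≤ 2 * b * |x - m|}, ENNReal.ofReal (3 / (2 * w)) := by
          refine setLIntegral_mono' hmeas fun x hx => ENNReal.ofReal_le_ofReal ?_
          rw [le_div_iff₀ (by positivity)]
          calc gaussianPDFReal m v x * (2 * w) ≤ gaussianPDFReal m v x * (3 * |x - m|) :=
                mul_le_mul_of_nonneg_left (hxw x hx).1 (gaussianPDFReal_nonneg _ _ _)
            _ = 3 * (gaussianPDFReal m v x * |x - m|) := by ring
            _ ≤ 3 := by linarith [gaussianPDFReal_mul_abs_le_one m v x]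
      _ = ENNReal.ofReal (3 / (2 * w)) * volume {x | |x - z| ≤ 2 * b * |x - m|} :=
          setLIntegral_const _ _
      _ ≤ ENNReal.ofReal (3 / (2 * w)) * volume (Metric.closedBall z (4 * b * w)) := by gcongr
      _ = ENNReal.ofReal (12 * b) := by
          rw [Real.volume_closedBall, ← ENNReal.ofReal_mul (by positivity)]
          congr 1
          field_simp
          ring

theorem enorm_le_ofReal_add_sq_div {ε : ℝ} (hε : 0 < ε) (x : ℝ) :
    ‖x‖ₑ ≤ ENNReal.ofReal ε + ‖x‖ₑ ^ 2 / ENNReal.ofReal ε := by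
  rw [← ofReal_norm, ← ENNReal.ofReal_pow (norm_nonneg _), ← ENNReal.ofReal_div_of_pos hε,
    ← ENNReal.ofReal_add hε.le (by positivity)]
  apply ENNReal.ofReal_le_ofReal
  have : ε + ‖x‖ ^ 2 / ε = (ε ^ 2 + ‖x‖ ^ 2) / ε := by field_simp
  rw [this, le_div_iff₀ hε]
  nlinarith [sq_nonneg (ε - ‖x‖), sq_nonneg ε, sq_nonneg ‖x‖]

/-- If `X` is Gaussian and independent of `N`, then `X` is within `N` of a given point with
probability at most a multiple of the mean of `N`. -/
theorem measure_enorm_sub_le_of_indepFun {Ω : Type*} [MeasurableSpace Ω] {P : Measure Ω}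
    [IsProbabilityMeasure P] {X : Ω → ℝ} {N : Ω → ℝ≥0∞} (hX : AEMeasurable X P)
    (hN : AEMeasurable N P) (hXN : IndepFun N X P) {m : ℝ} {v : NNReal} (hv : v ≠ 0)
    (hlaw : P.map X = gaussianReal m v) (z : ℝ) :
    P {ω | ‖X ω - z‖ₑ ≤ N ω} ≤ ENNReal.ofReal (2 * (√v)⁻¹) * ∫⁻ ω, N ω ∂P := by
  have hE : MeasurableSet {p : ℝ≥0∞ × ℝ | ‖p.2 - z‖ₑ ≤ p.1} :=
    measurableSet_le (by fun_prop) (by fun_prop)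
  have hpre : {ω | ‖X ω - z‖ₑ ≤ N ω} = (fun ω => (N ω, X ω)) ⁻¹' {p | ‖p.2 - z‖ₑ ≤ p.1} := rfl
  have : IsProbabilityMeasure (P.map X) := Measure.isProbabilityMeasure_map hX
  have : IsProbabilityMeasure (P.map N) := Measure.isProbabilityMeasure_map hN
  rw [hpre, ← Measure.map_apply_of_aemeasurable (hN.prodMk hX) hE,
    (indepFun_iff_map_prod_eq_prod_map_map hN hX).1 hXN, Measure.prod_apply hE]
  calc _ ≤ ∫⁻ n, ENNReal.ofReal (2 * (√v)⁻¹) * n ∂(P.map N) := by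
        refine lintegral_mono fun n => ?_
        have hball : Prod.mk n ⁻¹' {p : ℝ≥0∞ × ℝ | ‖p.2 - z‖ₑ ≤ p.1} = Metric.closedEBall z n := by
          ext x
          simp [edist_eq_enorm_sub]
        simp only [hball, hlaw]
        calc _ ≤ ENNReal.ofReal (√v)⁻¹ * volume (Metric.closedEBall z n) :=
              gaussianReal_le_inv_sqrt_mul_volume m hv _
          _ = _ := by
              rw [Real.volume_closedEBall, ENNReal.ofReal_mul (by norm_num)]
              simp only [ENNReal.ofReal_ofNat]
              ring
    _ = _ := by
        rw [lintegral_const_mul _ measurable_id', lintegral_map' (by fun_prop) hN]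

/-- Pythagoras for uncorrelated variables; it bounds a regression coefficient by the size of the
increment. -/
theorem sq_mul_variance_le_variance_of_covariance_eq_zero {Ω : Type*} [MeasurableSpace Ω]
    {P : Measure Ω} [IsProbabilityMeasure P] {X Y : Ω → ℝ} (hX : MemLp X 2 P) (hY : MemLp Y 2 P)
    (hcov : cov[Y, X; P] = 0) (β : ℝ) : β ^ 2 * Var[X; P] ≤ Var[Y + β • X; P] := by
  rw [variance_add hY (hX.const_smul β), covariance_smul_right, hcov, variance_smul]
  linarith [variance_nonneg Y P]

theorem variance_le_of_lintegral_sq_le {Ω : Type*} [MeasurableSpace Ω] {P : Measure Ω}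
    [IsProbabilityMeasure P] {X : Ω → ℝ} (hX : AEStronglyMeasurable X P) {c : ℝ} (hc : 0 ≤ c)
    (h : ∫⁻ ω, ‖X ω‖ₑ ^ 2 ∂P ≤ ENNReal.ofReal c) : Var[X; P] ≤ c := by
  refine (variance_le_expectation_sq hX).trans ?_
  change ∫ ω, X ω ^ 2 ∂P ≤ c
  rw [integral_eq_lintegral_of_nonneg_ae (ae_of_all _ fun ω => sq_nonneg _) (by fun_prop)]
  apply ENNReal.toReal_le_of_le_ofReal hc
  refine le_trans (le_of_eq (lintegral_congr fun ω => ?_)) h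
  simp [← ofReal_norm, ← ENNReal.ofReal_pow (abs_nonneg (X ω))]

theorem lintegral_ofReal_mul_enorm_sub_mean_le {Ω : Type*} [MeasurableSpace Ω] {P : Measure Ω}
    [IsProbabilityMeasure P] {X : Ω → ℝ} (hX : MemLp X 2 P) (hv : 0 < Var[X; P]) {k : ℝ}
    (hk : 0 ≤ k) :
    ∫⁻ ω, ENNReal.ofReal (k / √(Var[X; P])) * ‖X ω - P[X]‖ₑ ∂P ≤ ENNReal.ofReal k := by
  set v := Var[X; P] with hvdef
  have hs : 0 < √v := Real.sqrt_pos.2 hv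
  have hs2 : √v ^ 2 = v := Real.sq_sqrt hv.le
  have hpt : ∀ ω, ENNReal.ofReal (k / √v) * ‖X ω - P[X]‖ₑ ≤
      ENNReal.ofReal (k / 2) + ENNReal.ofReal (k / 2 / v) * ENNReal.ofReal ((X ω - P[X]) ^ 2) := by
    intro ω
    rw [← ofReal_norm, ← ENNReal.ofReal_mul (by positivity), ← ENNReal.ofReal_mul (by positivity),
      ← ENNReal.ofReal_add (by positivity) (by positivity)]
    apply ENNReal.ofReal_le_ofReal
    rw [Real.norm_eq_abs, ← sq_abs (X ω - P[X]), show k / 2 / v = k / 2 / √v ^ 2 by rw [hs2]]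
    have : k / 2 + k / 2 / √v ^ 2 * |X ω - P[X]| ^ 2 - k / √v * |X ω - P[X]| =
        k / 2 * (1 - |X ω - P[X]| / √v) ^ 2 := by field_simp; ring
    have h2 : 0 ≤ k / 2 * (1 - |X ω - P[X]| / √v) ^ 2 := by positivity
    linarith
  calc _ ≤ ∫⁻ ω, (ENNReal.ofReal (k / 2) +
        ENNReal.ofReal (k / 2 / v) * ENNReal.ofReal ((X ω - P[X]) ^ 2)) ∂P := lintegral_mono hpt
    _ = ENNReal.ofReal (k / 2) + ENNReal.ofReal (k / 2 / v) * ENNReal.ofReal v := by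
        rw [lintegral_add_left measurable_const, lintegral_const_mul' _ _ ENNReal.ofReal_ne_top,
          ← evariance_eq_lintegral_ofReal, ← ofReal_variance hX]
        simp [hvdef]
    _ = ENNReal.ofReal k := by
        rw [← ENNReal.ofReal_mul (by positivity), ← ENNReal.ofReal_add (by positivity)
          (by positivity)]
        congr 1
        field_simp
        ring

/-- A real Gaussian process with nondegenerate variance at `t₀` and oscillation of order `ε`
around `t₀` comes within `ε` of a given point with probability at most a multiple of `ε`. -/
theorem ProbabilityTheory.IsGaussianProcess.measure_exists_abs_sub_lt_le {Ω T : Type*}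
    [MeasurableSpace Ω] {P : Measure Ω} [IsProbabilityMeasure P] {V : T → Ω → ℝ} (hV : IsGaussianProcess V P)
    (hmeas : ∀ t, Measurable (V t)) {S : Set T} (hS : S.Countable) (t₀ : T) {σ k ε : ℝ}
    (hσ : 0 < σ) (hk : 0 ≤ k) (hε : 0 < ε) (hvar : σ ^ 2 ≤ Var[V t₀; P])
    {Θ : Ω → ℝ≥0∞} (hΘ : ∀ᵐ ω ∂P, ∀ t ∈ S, ‖V t ω - V t₀ ω‖ₑ ^ 2 ≤ Θ ω)
    (hΘint : ∫⁻ ω, Θ ω ∂P ≤ ENNReal.ofReal ((k * ε) ^ 2)) (hsmall : k * ε ≤ σ / 8) (z : ℝ) :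
    P {ω | ∃ t ∈ S, |V t ω - z| < ε} ≤
      ENNReal.ofReal (4 * (2 + k ^ 2 + 4 * k) / σ * ε) := by
  classical
  set X := V t₀
  set v := Var[X; P] with hvdef
  have hv : 0 < v := (by positivity : 0 < σ ^ 2).trans_le hvar
  have hσv : σ ≤ √v := Real.le_sqrt_of_sq_le hvar
  have hsv : 0 < √v := hσ.trans_le hσv
  have hmem : ∀ t, MemLp (V t) 2 P := fun t => (hV.hasGaussianLaw_eval t).memLp_two
  -- Regression of the increment `V t - X` on `X`. The residual `Y` is uncorrelated with `X`, hence,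
  -- by joint Gaussianity, independent of it as a process.
  set β : T → ℝ := fun t => cov[V t - X, X; P] / v
  set Y : T → Ω → ℝ := fun t => V t - X - β t • X
  have hYmem : ∀ t, MemLp (Y t) 2 P := fun t =>
    ((hmem t).sub (hmem t₀)).sub ((hmem t₀).const_smul _)
  have hYmeas : ∀ t, Measurable (Y t) := fun t =>
    ((hmeas t).sub (hmeas t₀)).sub ((hmeas t₀).const_smul _)
  have hcov : ∀ t, cov[Y t, X; P] = 0 := by
    intro t
    simp only [Y]
    rw [covariance_sub_left ((hmem t).sub (hmem t₀)) ((hmem t₀).const_smul _) (hmem t₀),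
      covariance_smul_left, covariance_self (hmeas t₀).aemeasurable]
    simp only [β]
    rw [div_mul_cancel₀ _ hv.ne', sub_self]
  set b := k * ε / √v
  have hb0 : 0 ≤ b := by positivity
  have hb : b ≤ 1 / 8 := by
    rw [div_le_iff₀ hsv]; linarith
  have hβ : ∀ t ∈ S, |β t| ≤ b := by
    intro t ht
    have h1 : Var[V t - X; P] ≤ (k * ε) ^ 2 := by
      refine variance_le_of_lintegral_sq_le ((hmeas t).sub (hmeas t₀)).aestronglyMeasurable
        (sq_nonneg _) (le_trans (lintegral_mono_ae ?_) hΘint)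
      filter_upwards [hΘ] with ω hω using hω t ht
    have h2 := sq_mul_variance_le_variance_of_covariance_eq_zero (hmem t₀) (hYmem t) (hcov t) (β t)
    have h3 : Y t + β t • X = V t - X := by simp [Y]
    rw [h3] at h2
    have h4 : (|β t| * √v) ^ 2 ≤ (k * ε) ^ 2 := by
      rw [mul_pow, sq_abs, Real.sq_sqrt hv.le]; exact h2.trans h1
    rw [le_div_iff₀ hsv]
    exact (sq_le_sq₀ (by positivity) (by positivity)).1 h4
  have hindep : IndepFun (fun ω (t : S) => Y t ω) (fun ω (_ : Unit) => X ω) P := by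
    refine IsGaussianProcess.indepFun_of_covariance_eq_zero (X := fun (t : S) => Y t)
      (Y := fun _ : Unit => X) ?_
      (fun t => (hYmeas t).aemeasurable) (fun _ => (hmeas t₀).aemeasurable)
      (fun t _ => hcov t)
    refine hV.of_isGaussianProcess fun s => ?_
    rcases s with t | u
    · refine ⟨{t.1, t₀},
        { toFun := fun x => x ⟨t.1, by simp⟩ - x ⟨t₀, by simp⟩ - β t * x ⟨t₀, by simp⟩
          map_add' := fun x y => by simp only [Pi.add_apply]; ring
          map_smul' := fun c x => by simp only [Pi.smul_apply, smul_eq_mul, RingHom.id_apply]; ring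
          cont := by fun_prop }, fun ω => ?_⟩
      simp [Y, X]
    · refine ⟨{t₀},
        { toFun := fun x => x ⟨t₀, by simp⟩
          map_add' := fun x y => by simp
          map_smul' := fun c x => by simp
          cont := by fun_prop }, fun ω => ?_⟩
      simp [X]
  have : Countable S := hS.to_subtype
  set m := P[X]
  -- Splitting `β t * X` as `β t * m + β t * (X - m)` leaves `N` a function of the residuals only,
  -- and its mean does not involve `m`.
  set N : Ω → ℝ≥0∞ := fun ω => 2 * (ENNReal.ofReal ε + ⨆ t : S, ‖Y t ω + β t * m‖ₑ)
  have hNmeas : Measurable N :=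
    (measurable_const.add (Measurable.iSup fun t : S =>
      ((hYmeas t).add_const _).enorm)).const_mul _
  have hNX : IndepFun N X P := by
    have hg : Measurable fun y : S → ℝ =>
        2 * (ENNReal.ofReal ε + ⨆ t : S, ‖y t + β t * m‖ₑ) :=
      (measurable_const.add (Measurable.iSup fun t : S =>
        ((measurable_pi_apply t).add_const _).enorm)).const_mul _
    exact hindep.comp hg (measurable_pi_apply ())
  have hNint : ∫⁻ ω, N ω ∂P ≤ ENNReal.ofReal (2 * (2 + k ^ 2 + k) * ε) := by
    have hpt : ∀ᵐ ω ∂P, N ω ≤ 2 * (ENNReal.ofReal (2 * ε) + ((ENNReal.ofReal ε)⁻¹ * Θ ω +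
        ENNReal.ofReal b * ‖X ω - m‖ₑ)) := by
      filter_upwards [hΘ] with ω hω
      simp only [N]
      rw [two_mul ε, ENNReal.ofReal_add hε.le hε.le, add_assoc]
      gcongr
      refine iSup_le fun t => ?_
      have h1 : Y t ω + β t * m = (V t ω - X ω) + -(β t * (X ω - m)) := by
        simp [Y]; ring
      have h2 : ‖β t‖ₑ ≤ ENNReal.ofReal b := by
        rw [← ofReal_norm]; exact ENNReal.ofReal_le_ofReal (hβ t t.2)
      calc _ ≤ ‖V t ω - X ω‖ₑ + ‖β t‖ₑ * ‖X ω - m‖ₑ := by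
            rw [h1]
            refine (enorm_add_le _ _).trans ?_
            rw [enorm_neg, enorm_mul]
        _ ≤ (ENNReal.ofReal ε + ‖V t ω - X ω‖ₑ ^ 2 / ENNReal.ofReal ε) +
            ENNReal.ofReal b * ‖X ω - m‖ₑ := by
            gcongr; exact enorm_le_ofReal_add_sq_div hε _
        _ ≤ (ENNReal.ofReal ε + Θ ω / ENNReal.ofReal ε) +
            ENNReal.ofReal b * ‖X ω - m‖ₑ := by
            gcongr; exact hω t t.2
        _ = _ := by rw [ENNReal.div_eq_inv_mul, add_assoc]
    have hε0 : (ENNReal.ofReal ε)⁻¹ ≠ ∞ := by simpa using hε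
    calc _ ≤ ∫⁻ ω, 2 * (ENNReal.ofReal (2 * ε) + ((ENNReal.ofReal ε)⁻¹ * Θ ω +
        ENNReal.ofReal b * ‖X ω - m‖ₑ)) ∂P := lintegral_mono_ae hpt
      _ = 2 * (ENNReal.ofReal (2 * ε) + ((ENNReal.ofReal ε)⁻¹ * ∫⁻ ω, Θ ω ∂P +
          ∫⁻ ω, ENNReal.ofReal b * ‖X ω - m‖ₑ ∂P)) := by
          -- `Θ` need not be measurable, so additivity always uses measurability of the other
          -- summand.
          rw [lintegral_const_mul' _ _ (by norm_num), lintegral_add_left measurable_const,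
            lintegral_add_right _ (((hmeas t₀).sub_const m).enorm.const_mul _),
            lintegral_const_mul' _ _ hε0]
          simp only [lintegral_const, measure_univ, mul_one]
          rfl
      _ ≤ 2 * (ENNReal.ofReal (2 * ε) + (ENNReal.ofReal ε⁻¹ * ENNReal.ofReal ((k * ε) ^ 2) +
          ENNReal.ofReal (k * ε))) := by
          rw [ENNReal.ofReal_inv_of_pos hε]
          gcongr
          exact lintegral_ofReal_mul_enorm_sub_mean_le (hmem t₀) hv (by positivity)
      _ = _ := by
          rw [← ENNReal.ofReal_mul (by positivity), ← ENNReal.ofReal_add (by positivity)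
            (by positivity), ← ENNReal.ofReal_add (by positivity) (by positivity),
            ← ENNReal.ofReal_ofNat 2, ← ENNReal.ofReal_mul (by positivity)]
          congr 1
          field_simp
          ring
  have hlaw : P.map X = gaussianReal m v.toNNReal :=
    (hV.hasGaussianLaw_eval t₀).map_eq_gaussianReal
  have hv' : v.toNNReal ≠ 0 := by simpa using hv
  -- Either `b * |X - m|` is at least half of `|X - z|`, which puts `X` in a multiplicative
  -- neighbourhood of `z`, or that term is absorbed on the left and `N` dominates `|X - z|`.
  have hsub : {ω | ∃ t ∈ S, |V t ω - z| < ε} ⊆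
      {ω | ‖X ω - z‖ₑ ≤ N ω} ∪ X ⁻¹' {x | |x - z| ≤ 2 * b * |x - m|} := by
    rintro ω ⟨t, ht, hlt⟩
    by_cases h : |X ω - z| ≤ 2 * b * |X ω - m|
    · exact Or.inr h
    left
    have h1 : X ω - z = (V t ω - z) + -(Y t ω + β t * m) + -(β t * (X ω - m)) := by
      simp [Y]; ring
    have h2 : |X ω - z| ≤ ε + |Y t ω + β t * m| + b * |X ω - m| := by
      calc _ ≤ |V t ω - z| + |Y t ω + β t * m| + |β t| * |X ω - m| := by
            rw [h1]
            refine (abs_add_three _ _ _).trans ?_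
            rw [abs_neg, abs_neg, abs_mul]
        _ ≤ _ := by gcongr; exact hβ t ht
    have h3 : |X ω - z| ≤ 2 * (ε + |Y t ω + β t * m|) := by linarith
    change ‖X ω - z‖ₑ ≤ N ω
    calc ‖X ω - z‖ₑ ≤ ENNReal.ofReal (2 * (ε + |Y t ω + β t * m|)) := by
          rw [← ofReal_norm]; exact ENNReal.ofReal_le_ofReal h3
      _ = 2 * (ENNReal.ofReal ε + ‖Y t ω + β t * m‖ₑ) := by
          rw [ENNReal.ofReal_mul (by norm_num), ENNReal.ofReal_add hε.le (abs_nonneg _),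
            ← ofReal_norm, Real.norm_eq_abs]
          simp
      _ ≤ N ω := by
          simp only [N]
          gcongr
          exact le_iSup (fun t : S => ‖Y t ω + β t * m‖ₑ) ⟨t, ht⟩
  have hset : MeasurableSet {x : ℝ | |x - z| ≤ 2 * b * |x - m|} :=
    measurableSet_le (by fun_prop) (by fun_prop)
  have hsvv : √(v.toNNReal : ℝ) = √v := by rw [Real.coe_toNNReal _ hv.le]
  calc _ ≤ P {ω | ‖X ω - z‖ₑ ≤ N ω} + P (X ⁻¹' {x | |x - z| ≤ 2 * b * |x - m|}) :=
        (measure_mono hsub).trans (measure_union_le _ _)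
    _ ≤ ENNReal.ofReal (2 * (√v)⁻¹) * ENNReal.ofReal (2 * (2 + k ^ 2 + k) * ε) +
        ENNReal.ofReal (12 * b) := by
        refine add_le_add ?_ ?_
        · refine (measure_enorm_sub_le_of_indepFun (hmeas t₀).aemeasurable hNmeas.aemeasurable hNX
            hv' hlaw z).trans ?_
          rw [hsvv]
          gcongr
        · rw [← Measure.map_apply (hmeas t₀) hset, hlaw]
          exact gaussianReal_abs_sub_le_mul_abs_le m hv' z hb0 hb
    _ = ENNReal.ofReal (4 * (2 + k ^ 2 + 4 * k) / √v * ε) := by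
        rw [← ENNReal.ofReal_mul (by positivity), ← ENNReal.ofReal_add (by positivity)
          (by positivity)]
        congr 1
        simp only [b]
        field_simp
        ring
    _ ≤ _ := by gcongr

/-! ### Coverings, and hitting a ball from a single block. -/

theorem ENNReal.add_sq_le_two_mul (a b : ℝ≥0∞) : (a + b) ^ 2 ≤ 2 * a ^ 2 + 2 * b ^ 2 := by
  rcases eq_or_ne a ∞ with rfl | ha
  · simp
  rcases eq_or_ne b ∞ with rfl | hb
  · simp
  lift a to NNReal using ha
  lift b to NNReal using hb
  have h : (a + b) ^ 2 ≤ 2 * a ^ 2 + 2 * b ^ 2 := by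
    rw [← mul_add]; exact add_sq_le
  exact_mod_cast h

/-- A maximal `ρ / 2`-separated subset of `I` is a net, and the disjoint balls of radius `ρ / 4`
around it fit in the 1-thickening of `I`; compare volumes. -/
theorem IsCompact.exists_finset_cover_card_mul_pow_le {d : ℕ} {I : Set (EuclideanSpace ℝ (Fin d))}
    (hI : IsCompact I) :
    ∃ C : ℝ, 0 < C ∧ ∀ ρ : ℝ, 0 < ρ → ρ ≤ 1 → ∃ F : Finset (EuclideanSpace ℝ (Fin d)),
      (F : Set (EuclideanSpace ℝ (Fin d))) ⊆ I ∧ I ⊆ ⋃ x ∈ F, Metric.ball x ρ ∧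
        F.card * ρ ^ d ≤ C := by
  set ω := volume.real (Metric.ball (0 : EuclideanSpace ℝ (Fin d)) 1)
  have hω : 0 < ω := volumeReal_unitBall_pos d
  have hfin : volume (Metric.thickening 1 I) ≠ ∞ := hI.isBounded.thickening.measure_lt_top.ne
  refine ⟨volume.real (Metric.thickening 1 I) * 4 ^ d / ω + 1, by positivity, fun ρ hρ hρ1 => ?_⟩
  set e : NNReal := (ρ / 2).toNNReal
  have he : (e : ℝ) = ρ / 2 := Real.coe_toNNReal _ (by positivity)
  have hpack : Metric.packingNumber e I ≠ ⊤ := by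
    obtain ⟨t, htI, htfin, htcov⟩ := hI.finite_cover_balls (e := ρ / 4) (by positivity)
    have hcov : Metric.IsCover (e / 2) I t := by
      intro x hx
      obtain ⟨y, hy, hxy⟩ := Set.mem_iUnion₂.1 (htcov hx)
      refine ⟨y, hy, ?_⟩
      change edist x y ≤ ((e / 2 : NNReal) : ℝ≥0∞)
      rw [edist_nndist, ENNReal.coe_le_coe, ← NNReal.coe_le_coe, coe_nndist]
      push_cast
      rw [he]
      linarith [Metric.mem_ball.1 hxy]
    have h1 := Metric.packingNumber_two_mul_le_externalCoveringNumber (e / 2) I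
    rw [mul_div_cancel₀ e two_ne_zero] at h1
    refine ((h1.trans hcov.externalCoveringNumber_le_encard).trans_lt ?_).ne
    exact htfin.encard_lt_top
  have hFfin : (Metric.maximalSeparatedSet e I).Finite := by
    rw [← Set.encard_ne_top_iff, Metric.encard_maximalSeparatedSet hpack]
    exact hpack
  refine ⟨hFfin.toFinset, by simpa using Metric.maximalSeparatedSet_subset, ?_, ?_⟩
  · intro x hx
    obtain ⟨y, hy, hxy⟩ := Metric.isCover_maximalSeparatedSet hpack hx
    change edist x y ≤ (e : ℝ≥0∞) at hxy
    rw [edist_nndist, ENNReal.coe_le_coe, ← NNReal.coe_le_coe, coe_nndist, he] at hxy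
    refine Set.mem_iUnion₂.2 ⟨y, by simpa using hy, ?_⟩
    rw [Metric.mem_ball]
    linarith
  · set F := hFfin.toFinset
    have hρ4 : 0 < ρ / 4 := by positivity
    have hdisj : (F : Set (EuclideanSpace ℝ (Fin d))).PairwiseDisjoint
        fun x => Metric.ball x (ρ / 4) := by
      intro x hx y hy hxy
      refine Metric.ball_disjoint_ball ?_
      have hsep := Metric.isSeparated_maximalSeparatedSet (ε := e) (A := I)
        (by simpa [F] using hx) (by simpa [F] using hy) hxy
      change (e : ℝ≥0∞) < edist x y at hsep
      rw [edist_nndist, ENNReal.coe_lt_coe, ← NNReal.coe_lt_coe, coe_nndist, he] at hsep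
      linarith
    have hsub : (⋃ x ∈ F, Metric.ball x (ρ / 4)) ⊆ Metric.thickening 1 I := by
      refine Set.iUnion₂_subset fun x hx => ?_
      have hxI : x ∈ I := Metric.maximalSeparatedSet_subset (by simpa [F] using hx)
      exact (Metric.ball_subset_ball (by linarith)).trans (Metric.ball_subset_thickening hxI 1)
    have hvol : (F.card : ℝ≥0∞) * ENNReal.ofReal ((ρ / 4) ^ d * ω) ≤
        volume (Metric.thickening 1 I) := by
      calc _ = ∑ x ∈ F, volume (Metric.ball x (ρ / 4)) := by
            simp_rw [volume_ball_eq_ofReal _ hρ4]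
            rw [Finset.sum_const, nsmul_eq_mul]
        _ = volume (⋃ x ∈ F, Metric.ball x (ρ / 4)) :=
            (measure_biUnion_finset hdisj fun _ _ => measurableSet_ball).symm
        _ ≤ _ := measure_mono hsub
    have hreal : F.card * ((ρ / 4) ^ d * ω) ≤ volume.real (Metric.thickening 1 I) := by
      have := ENNReal.toReal_mono hfin hvol
      rwa [ENNReal.toReal_mul, ENNReal.toReal_natCast, ENNReal.toReal_ofReal (by positivity)]
        at this
    have : (F.card : ℝ) * ρ ^ d ≤ volume.real (Metric.thickening 1 I) * 4 ^ d / ω := by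
      rw [le_div_iff₀ hω]
      calc (F.card : ℝ) * ρ ^ d * ω = F.card * ((ρ / 4) ^ d * ω) * 4 ^ d := by
            rw [div_pow]; field_simp
        _ ≤ _ := by gcongr
    linarith

/-- Integrated form of a pathwise oscillation bound in terms of an energy functional `E`. -/
theorem lintegral_iSup_enorm_sub_sq_le {d : ℕ} {ι Ω F : Type*} [MeasurableSpace Ω]
    [NormedAddCommGroup F] {P : Measure Ω} [IsProbabilityMeasure P]
    {V : EuclideanSpace ℝ (Fin d) → ι → Ω → F} {T : Set ι} {ρ c K : ℝ} (hρ : 0 < ρ)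
    {t₀ : EuclideanSpace ℝ (Fin d)} {E : (EuclideanSpace ℝ (Fin d) → F) → ℝ≥0∞}
    (hosc : ∀ f : EuclideanSpace ℝ (Fin d) → F, Continuous f → ∀ t ∈ Metric.ball t₀ ρ,
      ‖f t - f t₀‖ₑ ^ 2 ≤ ENNReal.ofReal c * (1 + E f / ENNReal.ofReal (ρ ^ (2 * d))))
    (hcont : ∀ᵐ ω ∂P, ∀ y ∈ T, Continuous fun t => V t y ω)
    (hE : ∫⁻ ω, ⨆ y ∈ T, E (fun t => V t y ω) ∂P ≤ ENNReal.ofReal (K * (2 * ρ) ^ (2 * d))) :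
    ∫⁻ ω, ⨆ t ∈ Metric.ball t₀ ρ, ⨆ y ∈ T, ‖V t y ω - V t₀ y ω‖ₑ ^ 2 ∂P ≤
      ENNReal.ofReal c * ENNReal.ofReal (1 + |K| * 2 ^ (2 * d)) := by
  have hρd : 0 < ρ ^ (2 * d) := by positivity
  have hρ' : (ENNReal.ofReal (ρ ^ (2 * d)))⁻¹ ≠ ∞ := by simpa using by positivity
  calc _ ≤ ∫⁻ ω, ENNReal.ofReal c * (1 + (ENNReal.ofReal (ρ ^ (2 * d)))⁻¹ *
        ⨆ y ∈ T, E (fun t => V t y ω)) ∂P := by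
        refine lintegral_mono_ae ?_
        filter_upwards [hcont] with ω hω
        refine iSup₂_le fun t ht => iSup₂_le fun y hy => ?_
        refine (hosc _ (hω y hy) t ht).trans ?_
        rw [ENNReal.div_eq_inv_mul]
        gcongr
        exact le_iSup₂ (f := fun y (_ : y ∈ T) => E (fun t => V t y ω)) y hy
    _ = ENNReal.ofReal c * (1 + (ENNReal.ofReal (ρ ^ (2 * d)))⁻¹ *
        ∫⁻ ω, ⨆ y ∈ T, E (fun t => V t y ω) ∂P) := by
        -- The supremum over `T` may be non-measurable; finite constants still factor out of its
        -- upper integral.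
        rw [lintegral_const_mul' _ _ ENNReal.ofReal_ne_top, lintegral_add_left measurable_const,
          lintegral_const_mul' _ _ hρ']
        simp
    _ ≤ ENNReal.ofReal c * (1 + ENNReal.ofReal (ρ ^ (2 * d))⁻¹ *
        ENNReal.ofReal (K * (2 * ρ) ^ (2 * d))) := by
        rw [ENNReal.ofReal_inv_of_pos hρd]
        gcongr
    _ ≤ _ := by
        gcongr
        rw [← ENNReal.ofReal_mul (by positivity), ENNReal.ofReal_add one_pos.le (by positivity),
          ENNReal.ofReal_one]
        refine add_le_add le_rfl (ENNReal.ofReal_le_ofReal ?_)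
        rw [mul_pow]
        calc (ρ ^ (2 * d))⁻¹ * (K * (2 ^ (2 * d) * ρ ^ (2 * d))) = K * 2 ^ (2 * d) := by
              field_simp
          _ ≤ |K| * 2 ^ (2 * d) := by gcongr; exact le_abs_self K

/-- A continuous Gaussian field with i.i.d. components whose oscillation on an open set `O` is of
order `ε` hits a ball of radius `ε` from `O` with probability at most a multiple of `ε ^ D`. -/
theorem IsContinuousGaussianIIDField.measure_hit_ball_le {d₁ d₂ D : ℕ} {Ω : Type*}
    [MeasurableSpace Ω] {P : Measure Ω} [IsProbabilityMeasure P]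
    {U : EuclideanSpace ℝ (Fin d₁) → EuclideanSpace ℝ (Fin d₂) → Ω → EuclideanSpace ℝ (Fin D)}
    (hU : IsContinuousGaussianIIDField P U)
    {O : Set (EuclideanSpace ℝ (Fin d₁) × EuclideanSpace ℝ (Fin d₂))} (hO : IsOpen O)
    (t₀ : EuclideanSpace ℝ (Fin d₁)) (x₀ : EuclideanSpace ℝ (Fin d₂)) {σ k ε : ℝ} (hσ : 0 < σ)
    (hk : 0 ≤ k) (hε : 0 < ε) (hvar : ∀ i, σ ^ 2 ≤ Var[fun ω => U t₀ x₀ ω i; P])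
    (hosc : ∃ a b : ℝ≥0∞, 2 * a + 2 * b ≤ ENNReal.ofReal ((k * ε) ^ 2) ∧
      (∫⁻ ω, ⨆ z ∈ O, ‖U z.1 z.2 ω - U t₀ z.2 ω‖ₑ ^ 2 ∂P ≤ a) ∧
      ∫⁻ ω, ⨆ z ∈ O, ‖U t₀ z.2 ω - U t₀ x₀ ω‖ₑ ^ 2 ∂P ≤ b)
    (hsmall : k * ε ≤ σ / 8) (w : EuclideanSpace ℝ (Fin D)) :
    P {ω | ∃ z ∈ O, U z.1 z.2 ω ∈ Metric.ball w ε} ≤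
      ENNReal.ofReal (4 * (2 + k ^ 2 + 4 * k) / σ * ε) ^ D := by
  obtain ⟨a, b, hab, ha, hb⟩ := hosc
  obtain ⟨S₀, hS₀, hS₀d⟩ :=
    TopologicalSpace.exists_countable_dense (EuclideanSpace ℝ (Fin d₁) × EuclideanSpace ℝ (Fin d₂))
  -- A countable set makes the suprema and events measurable. Continuity and openness of `O` and of
  -- the target ball turn a hit from `O` into a hit from `S`, almost surely.
  set S := S₀ ∩ O
  have hS : S.Countable := hS₀.mono Set.inter_subset_left
  set Θ₁ : Ω → ℝ≥0∞ := fun ω => ⨆ z ∈ S, ‖U z.1 z.2 ω - U t₀ z.2 ω‖ₑ ^ 2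
  set Θ₂ : Ω → ℝ≥0∞ := fun ω => ⨆ z ∈ S, ‖U t₀ z.2 ω - U t₀ x₀ ω‖ₑ ^ 2
  have hΘ₁ : Measurable Θ₁ := Measurable.biSup S hS fun z _ =>
    ((hU.measurable _ _).sub (hU.measurable _ _)).enorm.pow_const 2
  have hΘint : ∫⁻ ω, (2 * Θ₁ ω + 2 * Θ₂ ω) ∂P ≤ ENNReal.ofReal ((k * ε) ^ 2) := by
    rw [lintegral_add_left (hΘ₁.const_mul 2), lintegral_const_mul' _ _ (by norm_num),
      lintegral_const_mul' _ _ (by norm_num)]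
    refine le_trans ?_ hab
    gcongr
    · exact (lintegral_mono fun ω => biSup_mono fun _ h => h.2).trans ha
    · exact (lintegral_mono fun ω => biSup_mono fun _ h => h.2).trans hb
  have hcomp : ∀ i : Fin D, P {ω | ∃ z ∈ S, |U z.1 z.2 ω i - w i| < ε} ≤
      ENNReal.ofReal (4 * (2 + k ^ 2 + 4 * k) / σ * ε) := by
    intro i
    have hg : IsGaussianProcess
        (fun (z : EuclideanSpace ℝ (Fin d₁) × EuclideanSpace ℝ (Fin d₂)) ω => U z.1 z.2 ω i) P :=
      hU.gaussian.comp_left fun _ => EuclideanSpace.proj i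
    refine hg.measure_exists_abs_sub_lt_le (fun z => ?_) hS (t₀, x₀) hσ hk hε (hvar i)
      (ae_of_all _ fun ω z hz => ?_) hΘint hsmall (w i)
    · exact (EuclideanSpace.proj (𝕜 := ℝ) i).continuous.measurable.comp (hU.measurable z.1 z.2)
    -- Pass through `(t₀, z.2)`, changing one variable at a time.
    · have h1 : ‖U z.1 z.2 ω i - U t₀ x₀ ω i‖ₑ ≤
          ‖U z.1 z.2 ω - U t₀ z.2 ω‖ₑ + ‖U t₀ z.2 ω - U t₀ x₀ ω‖ₑ := by
        refine le_trans ?_ (enorm_add_le _ _)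
        rw [sub_add_sub_cancel, ← ofReal_norm, ← ofReal_norm]
        exact ENNReal.ofReal_le_ofReal (PiLp.norm_apply_le (U z.1 z.2 ω - U t₀ x₀ ω) i)
      calc _ ≤ (‖U z.1 z.2 ω - U t₀ z.2 ω‖ₑ + ‖U t₀ z.2 ω - U t₀ x₀ ω‖ₑ) ^ 2 := by
            gcongr
        _ ≤ _ := ENNReal.add_sq_le_two_mul _ _
        _ ≤ _ := by
            gcongr
            · exact le_iSup₂ (f := fun z (_ : z ∈ S) => ‖U z.1 z.2 ω - U t₀ z.2 ω‖ₑ ^ 2) z hz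
            · exact le_iSup₂ (f := fun z (_ : z ∈ S) => ‖U t₀ z.2 ω - U t₀ x₀ ω‖ₑ ^ 2) z hz
  -- Each coordinate may come close to `w i` at its own point of `S`. This enlarges the event but
  -- makes it an intersection of independent ones.
  set A : Fin D → Set (EuclideanSpace ℝ (Fin d₁) × EuclideanSpace ℝ (Fin d₂) → ℝ) :=
    fun i => {y | ∃ z ∈ S, |y z - w i| < ε}
  have hA : ∀ i, MeasurableSet (A i) := by
    intro i
    have : A i = ⋃ z ∈ S, {y | |y z - w i| < ε} := by ext; simp [A]
    rw [this]
    exact MeasurableSet.biUnion hS fun z _ => measurableSet_lt (by fun_prop) measurable_const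
  have hindep := hU.indep.measure_inter_preimage_eq_mul Finset.univ (sets := A) fun i _ => hA i
  calc P {ω | ∃ z ∈ O, U z.1 z.2 ω ∈ Metric.ball w ε}
      ≤ P (⋂ i ∈ (Finset.univ : Finset (Fin D)), (fun (ω : Ω) (z : EuclideanSpace ℝ (Fin d₁) ×
          EuclideanSpace ℝ (Fin d₂)) => U z.1 z.2 ω i) ⁻¹' A i) := by
        refine measure_mono_ae ?_
        filter_upwards [hU.continuous] with ω hω hex
        obtain ⟨z, hzO, hz⟩ := hex
        obtain ⟨z', hz', hz'S⟩ := hS₀d.inter_open_nonempty _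
          ((Metric.isOpen_ball.preimage hω).inter hO) ⟨z, hz, hzO⟩
        refine Set.mem_iInter₂.2 fun i _ => ⟨z', ⟨hz'S, hz'.2⟩, ?_⟩
        have h1 : ‖U z'.1 z'.2 ω - w‖ < ε := by
          rw [← dist_eq_norm]; exact hz'.1
        exact (PiLp.norm_apply_le (U z'.1 z'.2 ω - w) i).trans_lt h1
    _ = ∏ i : Fin D, P ((fun (ω : Ω) (z : EuclideanSpace ℝ (Fin d₁) ×
          EuclideanSpace ℝ (Fin d₂)) => U z.1 z.2 ω i) ⁻¹' A i) := hindep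
    _ ≤ ∏ _i : Fin D, ENNReal.ofReal (4 * (2 + k ^ 2 + 4 * k) / σ * ε) :=
        Finset.prod_le_prod' fun i _ => hcomp i
    _ = _ := by simp

/-! ### Hitting a small ball from the whole of `I × J`. -/

theorem IsGauge.exists_gaugeInv_eq {r : ℝ≥0∞} {q : ℝ → ℝ} (hq : IsGauge r q) {u : ℝ} (hu : 0 < u)
    (hdom : Set.Icc 0 u ⊆ gaugeDomain r) :
    ∃ δ : ℝ, 0 < δ ∧ ∀ ε ∈ Set.Ioc 0 δ, ∃ s ∈ Set.Ioc 0 u, q s = ε ∧ gaugeInv r q ε = s := by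
  refine ⟨q u, hq.apply_pos (hdom ⟨hu.le, le_rfl⟩) hu, fun ε hε => ?_⟩
  obtain ⟨s, hs, rfl⟩ := intermediate_value_Icc hu.le (hq.continuousOn.mono hdom)
    (show ε ∈ Set.Icc (q 0) (q u) by rw [hq.zero]; exact ⟨hε.1.le, hε.2⟩)
  have hs0 : s ≠ 0 := by
    rintro rfl
    exact hε.1.ne' hq.zero
  exact ⟨s, ⟨lt_of_le_of_ne hs.1 hs0.symm, hs.2⟩, rfl,
    hq.strictMonoOn.injOn.leftInvOn_invFunOn (hdom hs)⟩

/-- The field hits a small ball of radius `ε` from `I × J` with probability at most `C ḡ(ε)`. -/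
theorem exists_measure_hit_ball_le_gBar {d₁ d₂ D : ℕ} (hd₁ : 1 ≤ d₁) (hd₂ : 1 ≤ d₂)
    {I : Set (EuclideanSpace ℝ (Fin d₁))} {J : Set (EuclideanSpace ℝ (Fin d₂))}
    (hI : IsCompact I) (hJ : IsCompact J) {r₁ r₂ : ℝ≥0∞} {q₁ q₂ : ℝ → ℝ}
    (hq₁ : IsRegularGauge d₁ r₁ q₁) (hq₂ : IsRegularGauge d₂ r₂ q₂)
    {σ : ℝ} (K : ℝ) (hσ : 0 < σ) :
    ∃ C : ℝ, 0 < C ∧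
      ∀ (Ω : Type*) [MeasurableSpace Ω] (P : Measure Ω) [IsProbabilityMeasure P]
        (U : EuclideanSpace ℝ (Fin d₁) → EuclideanSpace ℝ (Fin d₂) → Ω →
          EuclideanSpace ℝ (Fin D)),
        IsContinuousGaussianIIDField P U →
        ∀ η : ℝ, 0 < η →
          (∀ t ∈ Metric.thickening η I, ∀ x ∈ Metric.thickening η J, ∀ i : Fin D,
            σ ^ 2 ≤ variance (fun ω => U t x ω i) P) →
          OscillationControl P U q₁ q₂ K (Metric.thickening η I) (Metric.thickening η J) →
          ∃ δ : ℝ, 0 < δ ∧ ∀ ε ∈ Set.Ioc 0 δ, ∀ w : EuclideanSpace ℝ (Fin D),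
            P {ω | ∃ t ∈ I, ∃ x ∈ J, U t x ω ∈ Metric.ball w ε} ≤
              ENNReal.ofReal C * ENNReal.ofReal (gBar d₁ d₂ D r₁ r₂ q₁ q₂ ε) := by
  obtain ⟨κ₁, u₁, c₁, hκ₁, hu₁, hc₁, hdom₁, hosc₁⟩ :=
    hq₁.exists_enorm_sub_sq_le hd₁ (EuclideanSpace ℝ (Fin D))
  obtain ⟨κ₂, u₂, c₂, hκ₂, hu₂, hc₂, hdom₂, hosc₂⟩ :=
    hq₂.exists_enorm_sub_sq_le hd₂ (EuclideanSpace ℝ (Fin D))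
  obtain ⟨CI, hCI, hcovI⟩ := hI.exists_finset_cover_card_mul_pow_le
  obtain ⟨CJ, hCJ, hcovJ⟩ := hJ.exists_finset_cover_card_mul_pow_le
  set k₁ := c₁ * (1 + |K| * 2 ^ (2 * d₁))
  set k₂ := c₂ * (1 + |K| * 2 ^ (2 * d₂))
  have hk₁ : 0 < k₁ := by positivity
  have hk₂ : 0 < k₂ := by positivity
  set k := √(2 * k₁ + 2 * k₂)
  have hk : 0 < k := Real.sqrt_pos.2 (by positivity)
  have hk2 : k ^ 2 = 2 * k₁ + 2 * k₂ := Real.sq_sqrt (by positivity)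
  set G := 4 * (2 + k ^ 2 + 4 * k) / σ
  have hG : 0 < G := by positivity
  -- Number of blocks times the hitting probability `(G * ε) ^ D` of each. The constant is fixed
  -- before the field, `η` and `ε₀`, which affect only the threshold `δ`.
  refine ⟨CI / κ₁ ^ d₁ * (CJ / κ₂ ^ d₂) * G ^ D, by positivity, ?_⟩
  intro Ω _ P _ U hU η hη hvar ⟨ε₀, hε₀, hctrl⟩
  have hscale : ∀ {d : ℕ} {r : ℝ≥0∞} {q : ℝ → ℝ}, IsGauge r q → ∀ {κ u : ℝ}, 0 < κ → 0 < u →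
      Set.Icc 0 u ⊆ gaugeDomain r → ∃ δ : ℝ, 0 < δ ∧ ∀ ε ∈ Set.Ioc 0 δ, ∃ s ∈ Set.Ioc 0 u,
        q s = ε ∧ gaugeInv r q ε = s ∧ κ * s ≤ 1 ∧ κ * s ≤ η ∧ 2 * (κ * s) < ε₀ := by
    intro d r q hq κ u hκ hu hdom
    -- The radius `κ * s` has to be admissible for the covering lemma, keep blocks inside the
    -- thickenings, and have its double below `ε₀`.
    set u' := min u (min (1 / κ) (min (η / κ) (ε₀ / (4 * κ))))
    have hu' : 0 < u' := by positivity
    obtain ⟨δ, hδ, h⟩ := hq.exists_gaugeInv_eq hu'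
      ((Set.Icc_subset_Icc_right (min_le_left _ _)).trans hdom)
    refine ⟨δ, hδ, fun ε hε => ?_⟩
    obtain ⟨s, hs, hqs, hinv⟩ := h ε hε
    have hs2 := hs.2
    simp only [u', le_min_iff] at hs2
    obtain ⟨h1, h2, h3, h4⟩ := hs2
    rw [le_div_iff₀ (by positivity)] at h2 h3 h4
    exact ⟨s, ⟨hs.1, h1⟩, hqs, hinv, by linarith, by linarith, by linarith⟩
  obtain ⟨δ₁, hδ₁, hs₁⟩ := hscale (d := d₁) hq₁.toIsGauge hκ₁ hu₁ hdom₁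
  obtain ⟨δ₂, hδ₂, hs₂⟩ := hscale (d := d₂) hq₂.toIsGauge hκ₂ hu₂ hdom₂
  refine ⟨min (min δ₁ δ₂) (σ / (8 * k)), by positivity, fun ε hε w => ?_⟩
  have hε2 := hε.2
  simp only [le_min_iff] at hε2
  obtain ⟨⟨hε₁, hε₂⟩, hε₃⟩ := hε2
  have hε0 : 0 < ε := hε.1
  rw [le_div_iff₀ (by positivity)] at hε₃
  obtain ⟨s₁, hs₁, hqs₁, hinv₁, h₁1, h₁η, h₁ε₀⟩ := hs₁ ε ⟨hε0, hε₁⟩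
  obtain ⟨s₂, hs₂, hqs₂, hinv₂, h₂1, h₂η, h₂ε₀⟩ := hs₂ ε ⟨hε0, hε₂⟩
  set ρ₁ := κ₁ * s₁
  set ρ₂ := κ₂ * s₂
  have hρ₁ : 0 < ρ₁ := mul_pos hκ₁ hs₁.1
  have hρ₂ : 0 < ρ₂ := mul_pos hκ₂ hs₂.1
  obtain ⟨F₁, hF₁I, hIF₁, hF₁⟩ := hcovI ρ₁ hρ₁ h₁1
  obtain ⟨F₂, hF₂J, hJF₂, hF₂⟩ := hcovJ ρ₂ hρ₂ h₂1
  have hblock : ∀ t₀ ∈ F₁, ∀ x₀ ∈ F₂, P {ω | ∃ z ∈ Metric.ball t₀ ρ₁ ×ˢ Metric.ball x₀ ρ₂,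
      U z.1 z.2 ω ∈ Metric.ball w ε} ≤ ENNReal.ofReal (G * ε) ^ D := by
    intro t₀ ht₀ x₀ hx₀
    have ht₀I : t₀ ∈ Metric.thickening η I := Metric.self_subset_thickening hη I (hF₁I ht₀)
    have hx₀J : x₀ ∈ Metric.thickening η J := Metric.self_subset_thickening hη J (hF₂J hx₀)
    have hsubJ : Metric.ball x₀ ρ₂ ⊆ Metric.thickening η J :=
      (Metric.ball_subset_ball h₂η).trans (Metric.ball_subset_thickening (hF₂J hx₀) η)
    refine hU.measure_hit_ball_le (Metric.isOpen_ball.prod Metric.isOpen_ball) t₀ x₀ hσ hk.le hε0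
      (hvar t₀ ht₀I x₀ hx₀J) ⟨ENNReal.ofReal (k₁ * ε ^ 2), ENNReal.ofReal (k₂ * ε ^ 2), ?_, ?_, ?_⟩
      (by linarith) w
    · apply le_of_eq
      have hsum : (k * ε) ^ 2 = 2 * (k₁ * ε ^ 2) + 2 * (k₂ * ε ^ 2) := by
        rw [mul_pow, hk2]; ring
      rw [hsum, ENNReal.ofReal_add (by positivity) (by positivity),
        ENNReal.ofReal_mul (p := 2) zero_le_two, ENNReal.ofReal_mul (p := 2) zero_le_two,
        ENNReal.ofReal_ofNat]
    · have h := lintegral_iSup_enorm_sub_sq_le (P := P) (V := U) (T := Metric.thickening η J)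
        (K := K) hρ₁ (hosc₁ s₁ hs₁ · · t₀)
        (by filter_upwards [hU.continuous] with ω hω using
              fun y _ => hω.comp (Continuous.prodMk_left y))
        ((hctrl (2 * ρ₁) (by positivity) h₁ε₀).1 t₀ ht₀I)
      rw [← ENNReal.ofReal_mul (by positivity), hqs₁] at h
      refine le_trans (lintegral_mono fun ω => ?_) (h.trans (ENNReal.ofReal_le_ofReal (le_of_eq ?_)))
      · refine iSup₂_le fun z hz => ?_
        exact le_iSup₂_of_le z.1 hz.1 (le_iSup₂_of_le z.2 (hsubJ hz.2) le_rfl)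
      · simp only [k₁]; ring
    · have h := lintegral_iSup_enorm_sub_sq_le (P := P) (V := fun x t => U t x)
        (T := Metric.thickening η I) (K := K) hρ₂ (hosc₂ s₂ hs₂ · · x₀)
        (by filter_upwards [hU.continuous] with ω hω using
              fun y _ => hω.comp (Continuous.prodMk_right y))
        ((hctrl (2 * ρ₂) (by positivity) h₂ε₀).2 x₀ hx₀J)
      rw [← ENNReal.ofReal_mul (by positivity), hqs₂] at h
      refine le_trans (lintegral_mono fun ω => ?_) (h.trans (ENNReal.ofReal_le_ofReal (le_of_eq ?_)))
      · refine iSup₂_le fun z hz => ?_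
        exact le_iSup₂_of_le z.2 hz.2 (le_iSup₂_of_le t₀ ht₀I le_rfl)
      · simp only [k₂]; ring
  have hcard₁ : (F₁.card : ℝ) ≤ CI / κ₁ ^ d₁ / s₁ ^ d₁ := by
    rw [div_div, ← mul_pow, le_div_iff₀ (by positivity)]
    exact hF₁
  have hcard₂ : (F₂.card : ℝ) ≤ CJ / κ₂ ^ d₂ / s₂ ^ d₂ := by
    rw [div_div, ← mul_pow, le_div_iff₀ (by positivity)]
    exact hF₂
  calc _ ≤ P (⋃ t₀ ∈ F₁, ⋃ x₀ ∈ F₂, {ω | ∃ z ∈ Metric.ball t₀ ρ₁ ×ˢ Metric.ball x₀ ρ₂,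
      U z.1 z.2 ω ∈ Metric.ball w ε}) := by
        refine measure_mono ?_
        rintro ω ⟨t, ht, x, hx, hω⟩
        obtain ⟨t₀, ht₀, htt₀⟩ := Set.mem_iUnion₂.1 (hIF₁ ht)
        obtain ⟨x₀, hx₀, hxx₀⟩ := Set.mem_iUnion₂.1 (hJF₂ hx)
        exact Set.mem_iUnion₂.2 ⟨t₀, ht₀, Set.mem_iUnion₂.2 ⟨x₀, hx₀, (t, x), ⟨htt₀, hxx₀⟩, hω⟩⟩
    _ ≤ ∑ t₀ ∈ F₁, ∑ x₀ ∈ F₂, P {ω | ∃ z ∈ Metric.ball t₀ ρ₁ ×ˢ Metric.ball x₀ ρ₂,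
          U z.1 z.2 ω ∈ Metric.ball w ε} :=
        (measure_biUnion_finset_le _ _).trans
          (Finset.sum_le_sum fun _ _ => measure_biUnion_finset_le _ _)
    _ ≤ ∑ t₀ ∈ F₁, ∑ x₀ ∈ F₂, ENNReal.ofReal (G * ε) ^ D :=
        Finset.sum_le_sum fun t₀ ht₀ => Finset.sum_le_sum fun x₀ hx₀ => hblock t₀ ht₀ x₀ hx₀
    _ = ENNReal.ofReal (F₁.card * (F₂.card * (G * ε) ^ D)) := by
        simp only [Finset.sum_const, nsmul_eq_mul]
        rw [ENNReal.ofReal_mul (p := F₁.card) (by positivity),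
          ENNReal.ofReal_mul (p := F₂.card) (by positivity),
          ENNReal.ofReal_pow (by positivity), ENNReal.ofReal_natCast, ENNReal.ofReal_natCast]
    _ ≤ ENNReal.ofReal (CI / κ₁ ^ d₁ / s₁ ^ d₁ * (CJ / κ₂ ^ d₂ / s₂ ^ d₂ * (G * ε) ^ D)) := by
        have := hs₁.1
        have := hs₂.1
        gcongr
    _ = _ := by
        rw [← ENNReal.ofReal_mul (by positivity), gBar, hinv₁, hinv₂]
        congr 1
        have := hs₁.1
        have := hs₂.1
        field_simp
        exact mul_pow G ε D

/-! ### From balls to Hausdorff measure. -/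

theorem theoremt2 {d₁ d₂ D : ℕ} (hd₁ : 1 ≤ d₁) (hd₂ : 1 ≤ d₂) (hD : 1 ≤ D)
    (I : Set (EuclideanSpace ℝ (Fin d₁))) (J : Set (EuclideanSpace ℝ (Fin d₂)))
    (hI : IsCompact I) (hJ : IsCompact J) (hIpos : 0 < volume I) (hJpos : 0 < volume J)
    (r₁ r₂ : ℝ≥0∞) (q₁ q₂ : ℝ → ℝ)
    (hq₁ : IsRegularGauge d₁ r₁ q₁) (hq₂ : IsRegularGauge d₂ r₂ q₂)
    (hg : ∃ ρ₀ : ℝ, 0 < ρ₀ ∧ StrictMonoOn (gBar d₁ d₂ D r₁ r₂ q₁ q₂) (Set.Ioo 0 ρ₀))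
    (σ K : ℝ) (hσ : 0 < σ) :
    ∃ C : ℝ, 0 < C ∧
      ∀ (Ω : Type*) [MeasurableSpace Ω] (P : Measure Ω) [IsProbabilityMeasure P]
        (U : EuclideanSpace ℝ (Fin d₁) → EuclideanSpace ℝ (Fin d₂) → Ω →
          EuclideanSpace ℝ (Fin D)),
        IsContinuousGaussianIIDField P U →
        ∀ η : ℝ, 0 < η →
          (∀ t ∈ Metric.thickening η I, ∀ x ∈ Metric.thickening η J, ∀ i : Fin D,
            σ ^ 2 ≤ variance (fun ω => U t x ω i) P) →
          OscillationControl P U q₁ q₂ K (Metric.thickening η I) (Metric.thickening η J) →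
          ∀ A : Set (EuclideanSpace ℝ (Fin D)), MeasurableSet A →
            P {ω | ∃ t ∈ I, ∃ x ∈ J, U t x ω ∈ A} ≤
              ENNReal.ofReal C * gHausdorff (gBar d₁ d₂ D r₁ r₂ q₁ q₂) A := by
  obtain ⟨C, hC, hhit⟩ := exists_measure_hit_ball_le_gBar (D := D) hd₁ hd₂ hI hJ hq₁ hq₂ K hσ
  refine ⟨C, hC, ?_⟩
  intro Ω _ P _ U hU η hη hvar hctrl A _
  obtain ⟨δ, hδ, hball⟩ := hhit Ω P U hU η hη hvar hctrl
  set g := gBar d₁ d₂ D r₁ r₂ q₁ q₂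
  have hC0 : ENNReal.ofReal C ≠ 0 := by simpa using hC
  rw [mul_comm, ← ENNReal.div_le_iff hC0 ENNReal.ofReal_ne_top]
  -- The measure is a supremum over scales, so the field-dependent scale `δ / 2`, for which `2 * ρ i
  -- ≤ δ`, costs nothing in the constant.
  refine le_iSup₂_of_le (δ / 2) (by positivity) (le_iInf fun x => le_iInf fun ρ => le_iInf ?_)
  rintro ⟨hρ, hcover⟩
  rw [ENNReal.div_le_iff hC0 ENNReal.ofReal_ne_top, mul_comm, ← ENNReal.tsum_mul_left]
  calc P {ω | ∃ t ∈ I, ∃ x ∈ J, U t x ω ∈ A}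
      ≤ P (⋃ i, {ω | ∃ t ∈ I, ∃ y ∈ J, U t y ω ∈ Metric.ball (x i) (ρ i)}) := by
        refine measure_mono ?_
        rintro ω ⟨t, ht, y, hy, hA⟩
        obtain ⟨i, hi⟩ := Set.mem_iUnion.1 (hcover hA)
        exact Set.mem_iUnion.2 ⟨i, t, ht, y, hy, hi⟩
    _ ≤ ∑' i, P {ω | ∃ t ∈ I, ∃ y ∈ J, U t y ω ∈ Metric.ball (x i) (ρ i)} :=
        measure_iUnion_le _
    _ ≤ ∑' i, ENNReal.ofReal C * ENNReal.ofReal (g (2 * ρ i)) := by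
        refine ENNReal.tsum_le_tsum fun i => ?_
        rcases (hρ i).1.eq_or_lt with h0 | h0
        · simp [← h0]
        -- The ball is enlarged to radius `2 * ρ i`, so that the estimate produces exactly the
        -- summand `g (2 * ρ i)`.
        · refine le_trans (measure_mono ?_)
            (hball (2 * ρ i) ⟨by positivity, by linarith [(hρ i).2]⟩ (x i))
          rintro ω ⟨t, ht, y, hy, h⟩
          exact ⟨t, ht, y, hy, Metric.ball_subset_ball (by linarith) h⟩
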